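/- All manifolds are smooth, finite dimensional, Hausdorff, second countable and without boundary. A discrete tangent bundle of a manifold $Q$ is a manifold $V$ with $\dim V=2\dim Q$ and two submersions $\partial^+,\partial^-:V\to Q$ such that $\ker T\partial^+\cap\ker T\partial^-=0$ and such that for each $q\in Q$ there is exactly one $v\in V$ with $\partial^+(v)=\partial^-(v)=q$. Every $\delta v\in T_vV$ then splits uniquely as $\delta v=\delta v^++\delta v^-$ with $\delta v^+\in\ker T_v\partial^-$ and $\delta v^-\in\ker T_v\partial^+$. A discrete constrained Lagrangian system (DCLS) consists of a discrete tangent bundle $(V,\partial^+,\partial^-)$ of $Q$, a smooth one-form $\sigma_d$ on $V$, an embedded submanifold $\mathcal D_d\subseteq V$ such that $\partial^+|_{\mathcal D_d}$ and $\partial^-|_{\mathcal D_d}$ are submersions, and a smooth subbundle $\mathcal E_d$ of the pullback bundle $(\partial^+|_{\mathcal D_d})^*TQ$. A pair $(v,\tilde v)$ is a solution pair if $v,\tilde v\in\mathcal D_d$, $\partial^+(v)=\partial^-(\tilde v)$, and $\sigma_d(v)\,\delta v+\sigma_d(\tilde v)\,\delta\tilde v=0$ for all $\delta v\in T_vV$,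 $\delta\tilde v\in T_{\tilde v}V$ with $T\partial^-(\delta v)=0$, $T\partial^+(\delta\tilde v)=0$ and $T\partial^+(\delta v)=T\partial^-(\delta\tilde v)\in(\mathcal E_d)_v$. An evolution of the DCLS is a map $F:U_F\to V_F$ between subsets of $V$ such that $(v,F(v))$ is a solution pair for every $v\in U_F\cap\mathcal D_d$. The DCLS is holonomic, with distribution $\mathcal D_d^Q$, if $\mathcal D_d^Q\subseteq TQ$ is a smooth involutive distribution of constant rank $r$ such that $(\mathcal E_d)_v=(\mathcal D_d^Q)_{\partial^+(v)}$ for all $v\in\mathcal D_d$; for all $v\in\mathcal D_d$ the points $\partial^-(v)$ and $\partial^+(v)$ are joined by a piecewise smooth curve tangent to $\mathcal D_d^Q$; $\dim\mathcal D_d=\dim Q+r$; and $d\sigma_d=0$. If a Lie group $G$ with Lie algebra $\mathfrak g$ acts smoothly on a manifold $M$, write $\xi m=\frac{d}{dt}\big|_{t=0}\exp(t\xi)m$ for $\xi\in\mathfrak g$, $m\in M$. A DCLS with smooth actions of $G$ on $Q$ and $V$ is symmetric if $\partial^\pm$ are equivariant, if $\sigma_d$, $\mathcal D_d$ and $\mathcal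 E_d$ are $G$-invariant, and if $\sigma_d(v)(\xi v)=0$ for all $\xi\in\mathfrak g$, $v\in\mathcal D_d$. The momentum maps $J^\pm:V\to\mathfrak g^*$ are $\langle J^+(v),\xi\rangle=\sigma_d(v)\big((\xi v)^+\big)$ and $\langle J^-(v),\xi\rangle=-\sigma_d(v)\big((\xi v)^-\big)$. **Corollary.** Let $F:U_F\to V_F$ be an evolution of a holonomic DCLS, and let a Lie group $G$ act smoothly on $V$ and on $Q$ such that 1. $\partial^+$ and $\partial^-$ are equivariant; 2. $\mathcal D_d^Q$ is $G$-invariant; 3. $\xi q\in(\mathcal D_d^Q)_q$ for all $\xi\in\mathfrak g$, $q\in Q$; 4. $\sigma_d$ is $G$-invariant and $\sigma_d(v)(\xi v)=0$ for all $\xi\in\mathfrak g$, $v\in\mathcal D_d$. Then * (a) $\xi v\in T_v\mathcal D_d$ for all $\xi\in\mathfrak g$, $v\in\mathcal D_d$, and for every $v\in\mathcal D_d$ one has $gv\in\mathcal D_d$ for all $g$ in a neighbourhood of the identity of $G$; moreover $\mathcal E_d$ is invariant: $g(\mathcal E_d)_v=(\mathcal E_d)_{gv}$ whenever $v,gv\in\mathcal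 D_d$; * (b) if $G$ is connected and $\mathcal D_d$ is closed in $V$, then $\mathcal D_d$ is $G$-invariant and the DCLS is symmetric; * (c) $F$ conserves momentum: for all $v\in U_F\cap\mathcal D_d$ one has $J^+(v)=J^-(v)$, $J^+(F(v))=J^-(F(v))$ and $J^+(F(v))=J^+(v)$. -/

import Mathlib

open scoped Manifold ContDiff Topology
open Set Module

noncomputable section

namespace DiscreteMechanics

section Differential

variable {E : Type*} [NormedAddCommGroup E] [NormedSpace ℝ E]
  {M : Type*} [TopologicalSpace M] [ChartedSpace E M]
  {E' : Type*} [NormedAddCommGroup E'] [NormedSpace ℝ E']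
  {N : Type*} [TopologicalSpace N] [ChartedSpace E' N]

variable (E E') in
/-- The tangent map `T_x f : T_x M → T_{f x} N`. -/
abbrev dmap (f : M → N) (x : M) :
    TangentSpace 𝓘(ℝ, E) x →L[ℝ] TangentSpace 𝓘(ℝ, E') (f x) :=
  mfderiv 𝓘(ℝ, E) 𝓘(ℝ, E') f x

variable (E E') in
/-- A smooth map all of whose tangent maps are onto. -/
structure IsSubmersive (f : M → N) : Prop where
  smooth : ContMDiff 𝓘(ℝ, E) 𝓘(ℝ, E') ∞ f
  surjective : ∀ x, Function.Surjective (dmap E E' f x)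

variable (E E') in
/-- A smooth embedding: a smooth topological embedding with injective tangent maps.  Its range is
an (embedded) submanifold of `N` with tangent spaces `range (T_x f)`. -/
structure IsSmoothEmb (f : M → N) : Prop where
  smooth : ContMDiff 𝓘(ℝ, E) 𝓘(ℝ, E') ∞ f
  injective : ∀ x, Function.Injective (dmap E E' f x)
  isEmbedding : Topology.IsEmbedding f

variable (E) in
/-- `Ξ` is a smooth rank `r` subbundle of the pullback bundle `f^* TN`: locally it is
spanned by `r` smooth sections of `TN` along `f`, and all fibres have dimension `r`. -/
def IsSubbundleAlong [IsManifold 𝓘(ℝ, E') ∞ N] (f : M → N) (Ξ : ∀ x : M, Submodule ℝ (TangentSpace 𝓘(ℝ, E') (f x)))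
    (r : ℕ) : Prop :=
  (∀ x, finrank ℝ (Ξ x) = r) ∧
  ∀ x₀ : M, ∃ U : Set M, IsOpen U ∧ x₀ ∈ U ∧
    ∃ s : Fin r → ∀ x : M, TangentSpace 𝓘(ℝ, E') (f x),
      (∀ i, ContMDiffOn 𝓘(ℝ, E) 𝓘(ℝ, E').tangent ∞
        (fun x => (⟨f x, s i x⟩ : TangentBundle 𝓘(ℝ, E') N)) U) ∧
      ∀ x ∈ U, Ξ x = Submodule.span ℝ (range fun i => s i x)

/-! ### Distributions -/

/-- A smooth distribution of constant rank `r`, i.e. a rank `r` subbundle of `TM`. -/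
def IsDistribution [IsManifold 𝓘(ℝ, E) ∞ M] (Δ : ∀ x : M, Submodule ℝ (TangentSpace 𝓘(ℝ, E) x)) (r : ℕ) : Prop :=
  IsSubbundleAlong E (id : M → M) Δ r

/-- `Δ` is involutive: the Lie bracket of two local smooth vector fields with values in `Δ` has
values in `Δ`. -/
def IsInvolutive [IsManifold 𝓘(ℝ, E) ∞ M] (Δ : ∀ x : M, Submodule ℝ (TangentSpace 𝓘(ℝ, E) x)) : Prop :=
  ∀ U : Set M, IsOpen U → ∀ X Y : ∀ x : M, TangentSpace 𝓘(ℝ, E) x,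
    ContMDiffOn 𝓘(ℝ, E) 𝓘(ℝ, E).tangent ∞ (fun x => (⟨x, X x⟩ : TangentBundle 𝓘(ℝ, E) M)) U →
    ContMDiffOn 𝓘(ℝ, E) 𝓘(ℝ, E).tangent ∞ (fun x => (⟨x, Y x⟩ : TangentBundle 𝓘(ℝ, E) M)) U →
    (∀ x ∈ U, X x ∈ Δ x) → (∀ x ∈ U, Y x ∈ Δ x) →
    ∀ x ∈ U, VectorField.mlieBracket 𝓘(ℝ, E) X Y x ∈ Δ x

/-- `x` and `y` are joined by a smooth curve on a compact interval, tangent to `Δ`. -/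
def IsJoinedBySmooth (Δ : ∀ x : M, Submodule ℝ (TangentSpace 𝓘(ℝ, E) x)) (x y : M) : Prop :=
  ∃ (a b : ℝ) (c : ℝ → M), a < b ∧ ContMDiffOn 𝓘(ℝ, ℝ) 𝓘(ℝ, E) ∞ c (Icc a b) ∧
    (∀ t ∈ Icc a b, mfderivWithin 𝓘(ℝ, ℝ) 𝓘(ℝ, E) c (Icc a b) t (1 : ℝ) ∈ Δ (c t)) ∧
    c a = x ∧ c b = y

/-- `y` is `Δ`-reachable from `x`: the two are joined by a piecewise smooth curve tangent to `Δ`,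
i.e. by a finite concatenation of smooth ones. -/
def IsReachable (Δ : ∀ x : M, Submodule ℝ (TangentSpace 𝓘(ℝ, E) x)) : M → M → Prop :=
  Relation.ReflTransGen (IsJoinedBySmooth Δ)

/-! ### One-forms -/

/-- The expression of a one-form in the preferred chart at `x₀`. -/
def formInChart (σ : ∀ x : M, TangentSpace 𝓘(ℝ, E) x →L[ℝ] ℝ) (x₀ : M) (y : E) : E →L[ℝ] ℝ :=
  (σ ((extChartAt 𝓘(ℝ, E) x₀).symm y)).comp (dmap E E (extChartAt 𝓘(ℝ, E) x₀).symm y)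

/-- Smoothness of a one-form. -/
def IsSmoothForm (σ : ∀ x : M, TangentSpace 𝓘(ℝ, E) x →L[ℝ] ℝ) : Prop :=
  ∀ x₀ : M, ContDiffOn ℝ ∞ (formInChart σ x₀) (extChartAt 𝓘(ℝ, E) x₀).target

/-- `dσ = 0` for a smooth one-form: in charts, `dσ(a, b) = (D_a σ)(b) - (D_b σ)(a)`. -/
def IsClosedForm (σ : ∀ x : M, TangentSpace 𝓘(ℝ, E) x →L[ℝ] ℝ) : Prop :=
  ∀ x₀ : M, ∀ y ∈ (extChartAt 𝓘(ℝ, E) x₀).target, ∀ a b : E,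
    fderiv ℝ (formInChart σ x₀) y a b - fderiv ℝ (formInChart σ x₀) y b a = 0

end Differential

section Action

variable {EG : Type*} [NormedAddCommGroup EG] [NormedSpace ℝ EG]
  (G : Type*) [TopologicalSpace G] [ChartedSpace EG G] [Group G]
  {E : Type*} [NormedAddCommGroup E] [NormedSpace ℝ E]
  {M : Type*} [TopologicalSpace M] [ChartedSpace E M] [MulAction G M]

/-- The infinitesimal generator `ξ ↦ ξ m`: the derivative at the identity of `g ↦ g • m`. -/
def infGen (m : M) : GroupLieAlgebra 𝓘(ℝ, EG) G →L[ℝ] TangentSpace 𝓘(ℝ, E) m :=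
  (mfderiv 𝓘(ℝ, EG) 𝓘(ℝ, E) (fun g : G => g • m) 1 : EG →L[ℝ] E)

/-- `G`-invariance of a distribution. -/
def IsInvariantDistribution (Δ : ∀ x : M, Submodule ℝ (TangentSpace 𝓘(ℝ, E) x)) : Prop :=
  ∀ (g : G) (x : M), (Δ x).map (dmap E E (fun y : M => g • y) x).toLinearMap = Δ (g • x)

/-- `G`-invariance of a one-form. -/
def IsInvariantForm (σ : ∀ x : M, TangentSpace 𝓘(ℝ, E) x →L[ℝ] ℝ) : Prop :=
  ∀ (g : G) (x : M) (w : TangentSpace 𝓘(ℝ, E) x),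
    σ (g • x) (dmap E E (fun y : M => g • y) x w) = σ x w

end Action

/-! ### Discrete tangent bundles and discrete constrained Lagrangian systems -/

section Systems

variable (EQ : Type*) [NormedAddCommGroup EQ] [NormedSpace ℝ EQ] [FiniteDimensional ℝ EQ]
  (Q : Type*) [TopologicalSpace Q] [ChartedSpace EQ Q] [IsManifold 𝓘(ℝ, EQ) ∞ Q]
  (EV : Type*) [NormedAddCommGroup EV] [NormedSpace ℝ EV] [FiniteDimensional ℝ EV]
  (V : Type*) [TopologicalSpace V] [ChartedSpace EV V]
  (ED : Type*) [NormedAddCommGroup ED] [NormedSpace ℝ ED] [FiniteDimensional ℝ ED]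
  (D : Type*) [TopologicalSpace D] [ChartedSpace ED D]

/-- A discrete tangent bundle `(V, ∂⁺, ∂⁻)` of `Q`. -/
structure DiscreteTangentBundle where
  plus : V → Q
  minus : V → Q
  dim_eq : finrank ℝ EV = 2 * finrank ℝ EQ
  plus_submersive : IsSubmersive EV EQ plus
  minus_submersive : IsSubmersive EV EQ minus
  ker_inf_ker : ∀ v, (dmap EV EQ plus v).ker ⊓
    (dmap EV EQ minus v).ker = ⊥
  existsUnique_zero : ∀ q : Q, ∃! v : V, plus v = q ∧ minus v = q

/-- A discrete constrained Lagrangian system `(V, ∂⁺, ∂⁻, σ, 𝒟, ℰ)`.  The velocity constraint `𝒟`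
is the submanifold of `V` that is the range of the smooth embedding `incl : D → V`. -/
structure DCLS extends DiscreteTangentBundle EQ Q EV V where
  σ : ∀ v : V, TangentSpace 𝓘(ℝ, EV) v →L[ℝ] ℝ
  σ_smooth : IsSmoothForm σ
  incl : D → V
  incl_emb : IsSmoothEmb ED EV incl
  plus_incl_submersive : IsSubmersive ED EQ (plus ∘ incl)
  minus_incl_submersive : IsSubmersive ED EQ (minus ∘ incl)
  force : ∀ d : D, Submodule ℝ (TangentSpace 𝓘(ℝ, EQ) (plus (incl d)))
  force_subbundle : ∃ k, IsSubbundleAlong ED (plus ∘ incl) force k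

variable {EQ Q EV V ED D}

namespace DiscreteTangentBundle

/-- The forward vertical space `ker T_v ∂⁻`. -/
def vertMinus (B : DiscreteTangentBundle EQ Q EV V) (v : V) :
    Submodule ℝ (TangentSpace 𝓘(ℝ, EV) v) :=
  (dmap EV EQ B.minus v).ker

/-- The backward vertical space `ker T_v ∂⁺`. -/
def vertPlus (B : DiscreteTangentBundle EQ Q EV V) (v : V) :
    Submodule ℝ (TangentSpace 𝓘(ℝ, EV) v) :=
  (dmap EV EQ B.plus v).ker

theorem isCompl_vert (B : DiscreteTangentBundle EQ Q EV V) (v : V) :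
    IsCompl (B.vertMinus v) (B.vertPlus v) := by
  have : FiniteDimensional ℝ (TangentSpace 𝓘(ℝ, EV) v) := inferInstanceAs (FiniteDimensional ℝ EV)
  have e1 := LinearMap.finrank_range_add_finrank_ker (dmap EV EQ B.minus v).toLinearMap
  have e2 := LinearMap.finrank_range_add_finrank_ker (dmap EV EQ B.plus v).toLinearMap
  rw [LinearMap.range_eq_top.2 (B.minus_submersive.surjective v), finrank_top] at e1
  rw [LinearMap.range_eq_top.2 (B.plus_submersive.surjective v), finrank_top] at e2
  have hd := B.dim_eq
  have h0 : Disjoint (B.vertMinus v) (B.vertPlus v) := by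
    rw [disjoint_iff, inf_comm]; exact B.ker_inf_ker v
  refine ⟨h0, codisjoint_iff.2 (Submodule.eq_top_of_disjoint _ _ ?_ h0)⟩
  change finrank ℝ EQ + finrank ℝ (B.vertMinus v) = finrank ℝ EV at e1
  change finrank ℝ EQ + finrank ℝ (B.vertPlus v) = finrank ℝ EV at e2
  change finrank ℝ EV ≤ _
  omega

/-- `δv ↦ δv⁺`, where `δv = δv⁺ + δv⁻`, `δv⁺ ∈ ker T∂⁻`, `δv⁻ ∈ ker T∂⁺`. -/
def plusPart (B : DiscreteTangentBundle EQ Q EV V) (v : V) :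
    TangentSpace 𝓘(ℝ, EV) v →ₗ[ℝ] TangentSpace 𝓘(ℝ, EV) v :=
  (B.vertMinus v).projection (B.vertPlus v) (B.isCompl_vert v)

/-- `δv ↦ δv⁻`, where `δv = δv⁺ + δv⁻`, `δv⁺ ∈ ker T∂⁻`, `δv⁻ ∈ ker T∂⁺`. -/
def minusPart (B : DiscreteTangentBundle EQ Q EV V) (v : V) :
    TangentSpace 𝓘(ℝ, EV) v →ₗ[ℝ] TangentSpace 𝓘(ℝ, EV) v :=
  (B.vertPlus v).projection (B.vertMinus v) (B.isCompl_vert v).symm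

end DiscreteTangentBundle

namespace DCLS

variable (S : DCLS EQ Q EV V ED D)

/-- The velocity constraint, as a subset of `V`. -/
def constraint : Set V := range S.incl

/-- The tangent space of the velocity constraint at one of its points. -/
def tangentConstraint (d : D) : Submodule ℝ (TangentSpace 𝓘(ℝ, EV) (S.incl d)) :=
  (dmap ED EV S.incl d).range

/-- `(v, v')` with `v = incl d`, `v' = incl d'` is a solution pair, i.e. it satisfies the discrete
Lagrange-d'Alembert principle for sequences of length two: it is first order, and
`σ(v) δv + σ(v') δv' = 0` for all variations with fixed boundary that are first order and
have `T∂⁺ δv` in the constraint force bundle. -/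
def IsSolutionPair (d d' : D) : Prop :=
  S.plus (S.incl d) = S.minus (S.incl d') ∧
  ∀ (w : TangentSpace 𝓘(ℝ, EV) (S.incl d)) (w' : TangentSpace 𝓘(ℝ, EV) (S.incl d')),
    dmap EV EQ S.minus (S.incl d) w = 0 →
    dmap EV EQ S.plus (S.incl d') w' = 0 →
    (dmap EV EQ S.plus (S.incl d) w : EQ) = (dmap EV EQ S.minus (S.incl d') w' : EQ) →
    dmap EV EQ S.plus (S.incl d) w ∈ S.force d →
    S.σ (S.incl d) w + S.σ (S.incl d') w' = 0

/-- `F : U → W` is an evolution map: `(v, F v)` is a solution pair for every `v ∈ U` in the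
velocity constraint.  (In particular `F v` is again in the velocity constraint.) -/
structure IsEvolution (F : V → V) (U W : Set V) : Prop where
  mapsTo : MapsTo F U W
  solution : ∀ d : D, S.incl d ∈ U → ∃ d' : D, S.incl d' = F (S.incl d) ∧ S.IsSolutionPair d d'

/-- The system has linear constraints, with constraint distribution `Δ` on `Q`. -/
structure HasLinearConstraints (Δ : ∀ q : Q, Submodule ℝ (TangentSpace 𝓘(ℝ, EQ) q)) : Prop where
  force_eq : ∀ d, S.force d = Δ (S.plus (S.incl d))
  reachable : ∀ d, IsReachable Δ (S.minus (S.incl d)) (S.plus (S.incl d))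
  /-- `dim 𝒟` is the dimension `dim Q + r` of the total space of the rank `r` bundle `Δ`. -/
  distribution_dim : ∃ r, IsDistribution Δ r ∧ finrank ℝ ED = finrank ℝ EQ + r

/-- The system is holonomic, with constraint distribution `Δ` on `Q`. -/
structure IsHolonomic (Δ : ∀ q : Q, Submodule ℝ (TangentSpace 𝓘(ℝ, EQ) q)) : Prop
    extends S.HasLinearConstraints Δ where
  involutive : IsInvolutive Δ
  closed : IsClosedForm S.σ

section Momentum

variable {EG : Type*} [NormedAddCommGroup EG] [NormedSpace ℝ EG]
  (G : Type*) [TopologicalSpace G] [ChartedSpace EG G] [Group G]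
  [MulAction G Q] [MulAction G V]

/-- `G`-invariance of the constraint force bundle: `g ℰ_v = ℰ_{g v}` whenever `v` and `g v` are in
the velocity constraint. -/
def IsInvariantForce : Prop :=
  ∀ (g : G) (d d' : D), S.incl d' = g • S.incl d →
    (S.force d).map (dmap EQ EQ (fun q : Q => g • q) (S.plus (S.incl d)) : EQ →L[ℝ] EQ).toLinearMap
      = S.force d'

/-- The given actions of `G` on `Q` and on `V` form an action on the system, i.e. the system is
symmetric. -/
structure IsSymmetric : Prop where
  plus_smul : ∀ (g : G) (v : V), S.plus (g • v) = g • S.plus v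
  minus_smul : ∀ (g : G) (v : V), S.minus (g • v) = g • S.minus v
  form_invariant : IsInvariantForm G S.σ
  constraint_invariant : ∀ (g : G), ∀ v ∈ S.constraint, g • v ∈ S.constraint
  force_invariant : S.IsInvariantForce G
  form_infGen : ∀ v ∈ S.constraint, ∀ ξ : GroupLieAlgebra 𝓘(ℝ, EG) G, S.σ v (infGen G v ξ) = 0

/-- The momentum map `J⁺_ξ(v) = σ(v)((ξ v)⁺)`. -/
def momentumPlus (v : V) : Dual ℝ (GroupLieAlgebra 𝓘(ℝ, EG) G) :=
  (S.σ v).toLinearMap ∘ₗ S.plusPart v ∘ₗ (infGen G v).toLinearMap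

/-- The momentum map `J⁻_ξ(v) = -σ(v)((ξ v)⁻)`. -/
def momentumMinus (v : V) : Dual ℝ (GroupLieAlgebra 𝓘(ℝ, EG) G) :=
  -((S.σ v).toLinearMap ∘ₗ S.minusPart v ∘ₗ (infGen G v).toLinearMap)

/-- `F` conserves momentum on `U`: on the part of the velocity constraint in `U`, the two momentum
maps agree, they agree at the image points, and their value is preserved by `F`. -/
def ConservesMomentum (F : V → V) (U : Set V) : Prop :=
  ∀ v ∈ U ∩ S.constraint,
    S.momentumPlus (EG := EG) G v = S.momentumMinus G v ∧
    S.momentumPlus (EG := EG) G (F v) = S.momentumMinus G (F v) ∧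
    S.momentumPlus (EG := EG) G (F v) = S.momentumPlus G v

end Momentum

end DCLS

end Systems

end DiscreteMechanics

end

/-! The heart of the matter is a local description of the velocity constraint `𝒟`: near each of its
points it contains the set of all `v ∈ V` for which the plaques of `∂⁻ v` and `∂⁺ v` are prescribed.
Infinitesimal generators on `Q` lie in the distribution `Δ`, so small group elements move points
within plaques. By equivariance they then preserve `𝒟` near each point.

To get this description, Frobenius' theorem (`exists_flowBox`) gives submersions `t i` on open sets
`U i` of `Q` whose level sets, the plaques, are tangent to `Δ`. At a point of `𝒟`, reachability puts
`∂⁻` and `∂⁺` in one leaf. As `Q` is second countable, a leaf meets each `U j` in only countably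
many plaques (`countable_image_leaf`). A continuous function with countably many values on a
connected set is constant, so along `𝒟` the plaque of `∂⁻` locally determines that of `∂⁺`
(`eventually_plus_eq`). Differentiated, this says that a vector tangent to `𝒟` with `∂⁻`-component
in `Δ` has its `∂⁺`-component in `Δ`. Since `dim 𝒟 = dim Q + r`, such vectors form a space of
dimension `2r` that embeds in `Δ × Δ`, hence fills it (`exists_flatDmap_incl_eq`). This gives
tangency of the generators, and through an open mapping argument the local description
(`eventually_mem_constraint`).

For a connected group and closed `𝒟`, local invariance makes `{g | g v ∈ 𝒟}` clopen, so it is all of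
`G`. Conservation of momentum is Noether's argument: the variations `(ξ v)⁺` and `(ξ v')⁻` are
admissible in the Lagrange-d'Alembert principle, and their actions under `σ` are `J⁺(v)` and
`-J⁻(v')`. On `𝒟` moreover `J⁺ - J⁻ = σ(ξ v) = 0`.

Frobenius' theorem itself is reduced to commuting fields by normalizing a frame. These fields are
straightened by their joint flow, which the implicit function theorem in `C([0,1], E)` provides. The
flow boxes are `C¹`, which is all that is used afterwards. -/

noncomputable section

namespace DiscreteMechanics

/-! ### Differentiability of superposition operators on spaces of continuous functions. -/

section Nemytskii

variable {X : Type*} [TopologicalSpace X] [CompactSpace X]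
  {E : Type*} [NormedAddCommGroup E] [NormedSpace ℝ E]
  {F : Type*} [NormedAddCommGroup F] [NormedSpace ℝ F]

/-- Bounded bilinear maps between normed spaces. -/
abbrev BoundedBilinear (E₁ E₂ E₃ : Type*) [NormedAddCommGroup E₁] [NormedSpace ℝ E₁]
    [NormedAddCommGroup E₂] [NormedSpace ℝ E₂] [NormedAddCommGroup E₃] [NormedSpace ℝ E₃] :=
  E₁ →L[ℝ] E₂ →L[ℝ] E₃

variable (X E F) in
/-- Pointwise evaluation of a continuous family of operators, as a bounded bilinear map. -/
def pointwiseEval : BoundedBilinear C(X, E →L[ℝ] F) C(X, E) C(X, F) :=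
  LinearMap.mkContinuous₂
    (LinearMap.mk₂ ℝ (fun (L : C(X, E →L[ℝ] F)) (y : C(X, E)) =>
        (⟨fun s => L s (y s), by fun_prop⟩ : C(X, F)))
      (fun _ _ _ => by ext; simp) (fun _ _ _ => by ext; simp)
      (fun _ _ _ => by ext; simp) (fun _ _ _ => by ext; simp)) 1
    (fun L y => by
      rw [one_mul, ContinuousMap.norm_le _ (by positivity)]
      intro s
      exact ((L s).le_opNorm _).trans
        (mul_le_mul (L.norm_coe_le_norm s) (y.norm_coe_le_norm s) (by positivity) (by positivity)))

@[simp] theorem pointwiseEval_apply (L : C(X, E →L[ℝ] F)) (y : C(X, E)) (s : X) :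
    pointwiseEval X E F L y s = L s (y s) := rfl

/-- The composition operator `y ↦ f ∘ y` on continuous functions on a compact space. -/
def superposition (X : Type*) [TopologicalSpace X] {f : E → F} (hf : Continuous f) (y : C(X, E)) :
    C(X, F) :=
  (⟨f, hf⟩ : C(E, F)).comp y

@[simp] theorem superposition_apply {f : E → F} (hf : Continuous f) (y : C(X, E)) (s : X) :
    superposition X hf y s = f (y s) := rfl

theorem continuous_superposition {f : E → F} (hf : Continuous f) :
    Continuous (superposition X hf) :=
  ContinuousMap.continuous_postcomp _

/-- The remainder is estimated pointwise by the mean value inequality. Uniformity in the point comes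
from continuity in the sup norm of superposition with `fderiv ℝ f`. -/
theorem hasFDerivAt_superposition {f : E → F} (hf : ContDiff ℝ 1 f) (y : C(X, E)) :
    HasFDerivAt (superposition X hf.continuous)
      (pointwiseEval X E F (superposition X (hf.continuous_fderiv one_ne_zero) y)) y := by
  rw [hasFDerivAt_iff_isLittleO_nhds_zero, Asymptotics.isLittleO_iff]
  intro ε hε
  have hc := (continuous_superposition (X := X) (hf.continuous_fderiv one_ne_zero)).continuousAt
    (x := y)
  obtain ⟨δ, hδ, H⟩ := Metric.continuousAt_iff.1 hc ε hε
  filter_upwards [Metric.ball_mem_nhds (0 : C(X, E)) hδ] with h hh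
  rw [mem_ball_zero_iff] at hh
  rw [ContinuousMap.norm_le _ (by positivity)]
  intro s
  have hs : ‖h s‖ ≤ ‖h‖ := h.norm_coe_le_norm s
  have key : ‖f (y s + h s) - f (y s) - fderiv ℝ f (y s) (y s + h s - y s)‖
      ≤ ε * ‖y s + h s - y s‖ := by
    refine (convex_ball (y s) δ).norm_image_sub_le_of_norm_fderiv_le'
      (fun z _ => (hf.differentiable one_ne_zero) z) (fun z hz => ?_)
      (Metric.mem_ball_self hδ) ?_
    -- To reach an arbitrary `z` near `y s`, shift `y` by the constant `z - y s`. The shifted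
    -- function is `δ`-close to `y` and takes the value `z` at `s`.
    · have h1 : dist (y + ContinuousMap.const X (z - y s)) y < δ := by
        rw [dist_eq_norm, add_sub_cancel_left]
        refine lt_of_le_of_lt ?_ (mem_ball_iff_norm.1 hz)
        rw [ContinuousMap.norm_le _ (by positivity)]
        intro; rfl
      have h2 := (ContinuousMap.dist_apply_le_dist s).trans (H h1).le
      simpa [dist_eq_norm] using h2
    · simpa using hs.trans_lt hh
  simp only [add_sub_cancel_left] at key
  exact key.trans (by gcongr)

theorem contDiff_superposition {f : E → F} (hf : ContDiff ℝ 1 f) :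
    ContDiff ℝ 1 (superposition X hf.continuous) := by
  rw [contDiff_one_iff_hasFDerivAt]
  exact ⟨_, (pointwiseEval X E F).continuous.comp (continuous_superposition _),
    hasFDerivAt_superposition hf⟩

end Nemytskii

/-! ### Integration as a bounded operator on continuous curves. -/

section Primitive

variable {E : Type*} [NormedAddCommGroup E] [NormedSpace ℝ E]

theorem continuous_extend_unitInterval (y : C(unitInterval, E)) :
    Continuous fun s : ℝ => y (projIcc 0 1 zero_le_one s) := by fun_prop

variable (E) in
/-- The primitive vanishing at `0` of a continuous function on the unit interval. -/
def primitive : C(unitInterval, E) →L[ℝ] C(unitInterval, E) :=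
  LinearMap.mkContinuous
    { toFun := fun y => ⟨fun t => ∫ s in (0 : ℝ)..t, y (projIcc 0 1 zero_le_one s), by
        have := intervalIntegral.continuous_primitive (μ := MeasureTheory.volume)
          (fun a b => (continuous_extend_unitInterval y).intervalIntegrable a b) 0
        fun_prop⟩
      map_add' := fun y z => by
        ext t
        exact intervalIntegral.integral_add
          ((continuous_extend_unitInterval y).intervalIntegrable _ _)
          ((continuous_extend_unitInterval z).intervalIntegrable _ _)
      map_smul' := fun c y => by
        ext t
        exact intervalIntegral.integral_smul c _ } 1
    (fun y => by
      rw [one_mul, ContinuousMap.norm_le _ (by positivity)]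
      intro t
      have := intervalIntegral.norm_integral_le_of_norm_le_const (a := 0) (b := (t : ℝ))
        (C := ‖y‖) (f := fun s => y (projIcc 0 1 zero_le_one s))
        (fun s _ => y.norm_coe_le_norm _)
      refine this.trans (mul_le_of_le_one_right (by positivity) ?_)
      rw [sub_zero, abs_of_nonneg t.2.1]
      exact t.2.2)

theorem primitive_apply (y : C(unitInterval, E)) (t : unitInterval) :
    primitive E y t = ∫ s in (0 : ℝ)..t, y (projIcc 0 1 zero_le_one s) := rfl

end Primitive

/-! ### Joint flow of commuting vector fields by the implicit function theorem. -/

section JointFlow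

variable {A : Type*} [NormedAddCommGroup A] [NormedSpace ℝ A]
  {E : Type*} [NormedAddCommGroup E] [NormedSpace ℝ E]
  {T : E → A →L[ℝ] E}

/-- The defect of a curve `Y` from being the integral curve of `T a` starting at `b`. -/
def flowDefect (hT : Continuous T) (p : (A × E) × C(unitInterval, E)) : C(unitInterval, E) :=
  p.2 - ContinuousMap.const _ p.1.2 -
    primitive E (pointwiseEval _ A E (superposition _ hT p.2) (ContinuousMap.const _ p.1.1))

variable (E) in
/-- Constant functions, as a bounded linear map. -/
def constCLM : E →L[ℝ] C(unitInterval, E) :=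
  LinearMap.mkContinuous
    { toFun := ContinuousMap.const _
      map_add' := fun _ _ => rfl
      map_smul' := fun _ _ => rfl } 1
    (fun y => by
      rw [one_mul, ContinuousMap.norm_le _ (by positivity)]
      intro; rfl)

@[simp] theorem constCLM_apply (x : E) (s : unitInterval) : constCLM E x s = x := rfl

theorem flowDefect_eq (hT : Continuous T) (p : (A × E) × C(unitInterval, E)) :
    flowDefect hT p = p.2 - constCLM E p.1.2 -
      primitive E (pointwiseEval _ A E (superposition _ hT p.2) (constCLM A p.1.1)) := rfl

/-- Under the primitive, the first summand comes from varying the parameter `a`, the second from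
varying the curve inside `T`. Setting `L` to zero is the linearized flow equation in integral form.
-/
theorem hasFDerivAt_flowDefect (hT : ContDiff ℝ 1 T) (p : (A × E) × C(unitInterval, E)) :
    ∃ L : (A × E) × C(unitInterval, E) →L[ℝ] C(unitInterval, E),
      HasFDerivAt (flowDefect hT.continuous) L p ∧
      ∀ u v h, L ((u, v), h) = h - constCLM E v - primitive E
        (pointwiseEval _ A E (superposition _ hT.continuous p.2) (constCLM A u) +
         pointwiseEval _ A E (pointwiseEval _ E (A →L[ℝ] E)
          (superposition _ (hT.continuous_fderiv one_ne_zero) p.2) h) (constCLM A p.1.1)) := by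
  have h1 : HasFDerivAt (fun p : (A × E) × C(unitInterval, E) =>
      superposition unitInterval hT.continuous p.2) _ p :=
    (hasFDerivAt_superposition hT p.2).comp p hasFDerivAt_snd
  have h2 : HasFDerivAt (fun p : (A × E) × C(unitInterval, E) =>
      pointwiseEval unitInterval A E (superposition _ hT.continuous p.2)) _ p :=
    (pointwiseEval unitInterval A E).hasFDerivAt.comp p h1
  have h3 : HasFDerivAt (fun p : (A × E) × C(unitInterval, E) => constCLM A p.1.1) _ p :=
    (constCLM A).hasFDerivAt.comp p (hasFDerivAt_fst.comp p hasFDerivAt_fst)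
  have h4 : HasFDerivAt (fun p : (A × E) × C(unitInterval, E) => constCLM E p.1.2) _ p :=
    (constCLM E).hasFDerivAt.comp p (hasFDerivAt_snd.comp p hasFDerivAt_fst)
  have h5 : HasFDerivAt (flowDefect hT.continuous) _ p :=
    (hasFDerivAt_snd.sub h4).sub ((primitive E).hasFDerivAt.comp p (h2.clm_apply h3))
  refine ⟨_, h5, fun u v h => ?_⟩
  rfl

theorem contDiff_flowDefect (hT : ContDiff ℝ 1 T) : ContDiff ℝ 1 (flowDefect hT.continuous) := by
  have h1 : ContDiff ℝ 1 fun p : (A × E) × C(unitInterval, E) =>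
      superposition unitInterval hT.continuous p.2 :=
    (contDiff_superposition hT).comp contDiff_snd
  have h2 : ContDiff ℝ 1 fun p : (A × E) × C(unitInterval, E) =>
      pointwiseEval unitInterval A E (superposition _ hT.continuous p.2) :=
    (pointwiseEval unitInterval A E).contDiff.comp h1
  have h3 : ContDiff ℝ 1 fun p : (A × E) × C(unitInterval, E) => constCLM A p.1.1 :=
    (constCLM A).contDiff.comp (contDiff_fst.comp contDiff_fst)
  have h4 : ContDiff ℝ 1 fun p : (A × E) × C(unitInterval, E) => constCLM E p.1.2 :=
    (constCLM E).contDiff.comp (contDiff_snd.comp contDiff_fst)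
  exact (contDiff_snd.sub h4).sub ((primitive E).contDiff.comp (h2.clm_apply h3))

variable [CompleteSpace E]

/-- Along an integral curve `Y` of `T a` in the region where the fields `T u` commute, the field
`s T(Y s) u` solves the linearized equation with source `T(Y s) u`. -/
theorem linearized_solution (hT : ContDiff ℝ 1 T) {a : A} {b : E} {Y : C(unitInterval, E)}
    (hY : flowDefect hT.continuous ((a, b), Y) = 0)
    (hcomm : ∀ s, ∀ u v, fderiv ℝ T (Y s) (T (Y s) u) v = fderiv ℝ T (Y s) (T (Y s) v) u) (u : A) :
    ∃ w : C(unitInterval, E), (∀ s, w s = (s : ℝ) • T (Y s) u) ∧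
      w = primitive E
        (pointwiseEval _ A E (superposition _ hT.continuous Y) (constCLM A u) +
         pointwiseEval _ A E (pointwiseEval _ E (A →L[ℝ] E)
          (superposition _ (hT.continuous_fderiv one_ne_zero) Y) w) (constCLM A a)) := by
  have hTc := hT.continuous
  let w : C(unitInterval, E) := ⟨fun s => (s : ℝ) • T (Y s) u, by fun_prop⟩
  refine ⟨w, fun _ => rfl, ?_⟩
  let g : ℝ → E := fun s => T (Y (projIcc 0 1 zero_le_one s)) a
  -- The curve `y` extends `Y` differentiably to all of `ℝ`, so that ordinary derivatives are
  -- available at the endpoints too.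
  have hg : Continuous g := by fun_prop
  let y : ℝ → E := fun t => b + ∫ s in (0 : ℝ)..t, g s
  have hy : ∀ t, HasDerivAt y (g t) t := fun t =>
    (intervalIntegral.integral_hasDerivAt_right (hg.intervalIntegrable _ _)
      (hg.stronglyMeasurableAtFilter _ _) hg.continuousAt).const_add b
  have hyY : ∀ t : unitInterval, y t = Y t := by
    intro t
    have := congrArg (fun z : C(unitInterval, E) => z t) hY
    simp only [flowDefect_eq, ContinuousMap.sub_apply, constCLM_apply, primitive_apply,
      pointwiseEval_apply, superposition_apply, ContinuousMap.zero_apply] at this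
    rw [sub_sub, sub_eq_zero] at this
    exact this.symm
  have hproj : ∀ t ∈ Icc (0 : ℝ) 1, Y (projIcc 0 1 zero_le_one t) = y t := by
    intro t ht
    rw [projIcc_of_mem _ ht, hyY ⟨t, ht⟩]
  ext t
  rw [primitive_apply]
  -- The product rule gives `T(y) u + s DT(y)(T(y) a) u`. Commutation exchanges `a` and `u` in the
  -- second term, which becomes `DT(y)(s T(y) u) a`, the linearization applied to `w`.
  have hd : ∀ s ∈ uIcc (0 : ℝ) t, HasDerivAt (fun s : ℝ => s • T (y s) u)
      ((pointwiseEval _ A E (superposition _ hT.continuous Y) (constCLM A u) +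
         pointwiseEval _ A E (pointwiseEval _ E (A →L[ℝ] E)
          (superposition _ (hT.continuous_fderiv one_ne_zero) Y) w) (constCLM A a))
        (projIcc 0 1 zero_le_one s)) s := by
    intro s hs
    rw [uIcc_of_le t.2.1] at hs
    have hs' : s ∈ Icc (0 : ℝ) 1 := ⟨hs.1, hs.2.trans t.2.2⟩
    have h1 : HasDerivAt (fun s => T (y s)) (fderiv ℝ T (y s) (g s)) s :=
      ((hT.differentiable one_ne_zero) (y s)).hasFDerivAt.comp_hasDerivAt s (hy s)
    have h2 : HasDerivAt (fun s => T (y s) u) (fderiv ℝ T (y s) (g s) u) s := by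
      simpa using h1.clm_apply (hasDerivAt_const s u)
    have h3 := (hasDerivAt_id s).smul h2
    convert! h3 using 1
    have e := hproj s hs'
    have hc := hcomm (projIcc 0 1 zero_le_one s) a u
    have hps : ((projIcc 0 1 zero_le_one s : unitInterval) : ℝ) = s := by
      rw [projIcc_of_mem _ hs']
    simp only [ContinuousMap.add_apply, pointwiseEval_apply, superposition_apply, constCLM_apply]
    rw [e] at hc ⊢
    change _ + (fderiv ℝ T (y s)
      (((projIcc 0 1 zero_le_one s : unitInterval) : ℝ) •
        T (Y (projIcc 0 1 zero_le_one s)) u)) a = _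
    simp only [g, hps, e, map_smul, smul_apply, id, one_smul, hc]
    exact add_comm _ _
  rw [intervalIntegral.integral_eq_sub_of_hasDerivAt hd
    ((continuous_extend_unitInterval _).intervalIntegrable _ _)]
  simp [w, hyY]

variable [CompleteSpace A]

/-- Commuting vector fields `T u`, depending linearly on `u`, have a joint flow
`α (a, b) = exp(T a) b` which is continuously differentiable near `a = 0`, and whose derivative in
the direction `u` of `a` is `T u`. -/
theorem exists_jointFlow (hT : ContDiff ℝ 1 T) {x₀ : E}
    (hcomm : ∀ᶠ x in 𝓝 x₀, ∀ u v, fderiv ℝ T x (T x u) v = fderiv ℝ T x (T x v) u) :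
    ∃ α : A × E → E, ContDiffAt ℝ 1 α (0, x₀) ∧ (∀ᶠ b in 𝓝 x₀, α (0, b) = b) ∧
      ∀ᶠ p in 𝓝 ((0 : A), x₀), ∀ u, fderiv ℝ α p (u, 0) = T (α p) u := by
  set Φ := flowDefect hT.continuous with hΦ
  set p₀ : (A × E) × C(unitInterval, E) := ((0, x₀), constCLM E x₀)
  have hC : ContDiff ℝ 1 Φ := contDiff_flowDefect hT
  -- At `a = 0` the curve enters the integral term only through a factor `a`, so the partial
  -- derivative in the curve is the identity.
  have hpart : fderiv ℝ Φ p₀ ∘L .inr ℝ (A × E) C(unitInterval, E) = .id ℝ _ := by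
    obtain ⟨L, hL, hL'⟩ := hasFDerivAt_flowDefect hT p₀
    rw [hL.fderiv]
    ext1 h
    change L ((0, 0), h) = h
    rw [hL']
    simp [p₀]
  have hzero : ∀ b : E, Φ ((0, b), constCLM E b) = 0 := by
    intro b
    simp [hΦ, flowDefect_eq]
  have hinv : (fderiv ℝ Φ p₀ ∘L .inr ℝ (A × E) C(unitInterval, E)).IsInvertible := by
    rw [hpart]; exact ⟨.refl ℝ _, rfl⟩
  set ψ := hC.contDiffAt.implicitFunction one_ne_zero hinv with hψ
  have hψ₀ : ψ (0, x₀) = constCLM E x₀ :=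
    hC.contDiffAt.implicitFunction_apply_self one_ne_zero hinv
  have hψC : ContDiffAt ℝ 1 ψ (0, x₀) :=
    hC.contDiffAt.contDiffAt_implicitFunction one_ne_zero hinv
  have hψeq : ∀ᶠ p in 𝓝 ((0 : A), x₀), Φ (p, ψ p) = 0 := by
    filter_upwards [hC.contDiffAt.eventually_apply_implicitFunction one_ne_zero hinv] with p hp
    rw [hp, hzero]
  have hψconst : ∀ᶠ b in 𝓝 x₀, ψ (0, b) = constCLM E b := by
    have hcont : ContinuousAt (fun b : E => (((0 : A), b), constCLM E b)) x₀ := by fun_prop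
    have := hcont.eventually
      (hC.contDiffAt.eventually_apply_eq_iff_implicitFunction one_ne_zero hinv)
    filter_upwards [this] with b hb
    exact hb.1 (by rw [hzero, hzero])
  let ev : C(unitInterval, E) →L[ℝ] E := ContinuousMap.evalCLM ℝ (1 : unitInterval)
  refine ⟨fun p => ψ p 1, ev.contDiff.contDiffAt.comp _ hψC, ?_, ?_⟩
  · filter_upwards [hψconst] with b hb
    rw [hb]; rfl
  have hψd : ∀ᶠ p in 𝓝 ((0 : A), x₀), ContDiffAt ℝ 1 ψ p := hψC.eventually (by simp)
  have hgraph : ContinuousAt (fun p => (p, ψ p)) ((0 : A), x₀) :=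
    continuousAt_id.prodMk hψC.continuousAt
  -- Near the base point the partial derivative in the curve stays at distance less than one from
  -- the identity, hence is injective. This is uniqueness for the linearized equation.
  have hinj : ∀ᶠ p in 𝓝 ((0 : A), x₀),
      ‖fderiv ℝ Φ (p, ψ p) ∘L .inr ℝ (A × E) C(unitInterval, E) - .id ℝ _‖ < 1 := by
    have hc : ContinuousAt (fun p => ‖fderiv ℝ Φ (p, ψ p) ∘L .inr ℝ (A × E) C(unitInterval, E)
        - .id ℝ _‖) ((0 : A), x₀) := by
      have h1 : ContinuousAt (fun p => fderiv ℝ Φ (p, ψ p)) ((0 : A), x₀) :=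
        (hC.continuous_fderiv one_ne_zero).continuousAt.comp hgraph
      exact ((h1.clm_comp continuousAt_const).sub continuousAt_const).norm
    refine hc.eventually_lt continuousAt_const ?_
    have : (((0 : A), x₀), ψ (0, x₀)) = p₀ := by rw [hψ₀]
    rw [this, hpart, sub_self]
    exact (norm_zero (E := C(unitInterval, E) →L[ℝ] C(unitInterval, E))).trans_lt zero_lt_one
  have hnear : ∀ᶠ p in 𝓝 ((0 : A), x₀), ∀ s, ∀ u v,
      fderiv ℝ T (ψ p s) (T (ψ p s) u) v = fderiv ℝ T (ψ p s) (T (ψ p s) v) u := by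
    obtain ⟨ε, hε, H⟩ := Metric.eventually_nhds_iff.1 hcomm
    have := Metric.tendsto_nhds.1 hψC.continuousAt.tendsto ε hε
    filter_upwards [this] with p hp s
    refine H ?_
    rw [hψ₀] at hp
    exact (ContinuousMap.dist_apply_le_dist (f := ψ p) (g := constCLM E x₀) s).trans_lt hp
  filter_upwards [hψeq.eventually_nhds, hψd, hinj, hnear] with p hp hd hi hn u
  obtain ⟨L, hL, hL'⟩ := hasFDerivAt_flowDefect hT (p, ψ p)
  obtain ⟨w, hw, hw'⟩ := linearized_solution hT (a := p.1) (b := p.2) hp.self_of_nhds hn u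
  have hψp := (hd.differentiableAt one_ne_zero).hasFDerivAt
  have hcomp : HasFDerivAt (fun p => Φ (p, ψ p)) _ p :=
    HasFDerivAt.comp (g := Φ) p hL ((hasFDerivAt_id p).prodMk hψp)
  have hz : HasFDerivAt (𝕜 := ℝ) (fun p => Φ (p, ψ p)) 0 p :=
    (hasFDerivAt_const (0 : C(unitInterval, E)) p).congr_of_eventuallyEq hp
  -- Both the derivative of `ψ` in the direction `u` and the explicit `w = s T(ψ) u` solve the
  -- linearized equation. By uniqueness they agree, and evaluation at `s = 1` gives the claim.
  have e1 : L ((u, 0), fderiv ℝ ψ p (u, 0)) = 0 := by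
    have := congrArg (fun M => M (u, 0)) (hcomp.unique hz)
    exact this
  have e2 : L ((u, 0), w) = 0 := by
    rw [hL']
    simp only [map_zero, sub_zero]
    exact sub_eq_zero.2 hw'
  set z := fderiv ℝ ψ p (u, 0) - w with hzdef
  have e3 : L ((0, 0), z) = 0 := by
    have : (((0 : A), (0 : E)), z) = ((u, 0), fderiv ℝ ψ p (u, 0)) - ((u, 0), w) := by
      simp [hzdef]
    rw [this, map_sub, e1, e2, sub_zero]
  have e4 : z = 0 := by
    by_contra hne
    rw [hL.fderiv] at hi
    have hle := (L ∘L .inr ℝ (A × E) C(unitInterval, E) - .id ℝ _).le_opNorm z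
    have hval : (L ∘L .inr ℝ (A × E) C(unitInterval, E) - .id ℝ _) z = -z := by
      change L ((0, 0), z) - z = -z
      rw [e3, zero_sub]
    rw [hval, norm_neg] at hle
    have := norm_pos_iff.2 hne
    nlinarith
  have e5 : HasFDerivAt (fun p => ψ p 1) (ev ∘L fderiv ℝ ψ p) p := ev.hasFDerivAt.comp p hψp
  rw [e5.fderiv]
  change (fderiv ℝ ψ p (u, 0)) 1 = T (ψ p 1) u
  rw [sub_eq_zero.1 (hzdef.symm.trans e4), hw]
  simp

end JointFlow

/-! ### Level sets of submersions between vector spaces -/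

section Calculus

variable {E : Type*} [NormedAddCommGroup E] [NormedSpace ℝ E]
  {F : Type*} [NormedAddCommGroup F] [NormedSpace ℝ F]
  {G : Type*} [NormedAddCommGroup G] [NormedSpace ℝ G]

theorem eventually_eq_of_hasFDerivAt_zero {g : E → G} {a : E}
    (hg : ∀ᶠ x in 𝓝 a, HasFDerivAt (𝕜 := ℝ) g 0 x) : ∀ᶠ x in 𝓝 a, g x = g a := by
  obtain ⟨ε, hε, H⟩ := Metric.eventually_nhds_iff_ball.1 hg
  filter_upwards [Metric.ball_mem_nhds a hε] with x hx
  exact Metric.isOpen_ball.is_const_of_fderiv_eq_zero (𝕜 := ℝ) (convex_ball a ε).isPreconnected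
    (fun y hy => (H y hy).differentiableAt.differentiableWithinAt) (fun y hy => (H y hy).fderiv)
    hx (Metric.mem_ball_self hε)

variable [CompleteSpace E] [FiniteDimensional ℝ F]

/-- The level set through `a` of a submersion at `a` is parametrized by the kernel of the
derivative. -/
theorem exists_levelSet_param {f : E → F} {f' : E →L[ℝ] F} {a : E} (hf : ContDiffAt ℝ 1 f a)
    (hf' : HasFDerivAt f f' a) (hsurj : Function.Surjective f') :
    ∃ (β : f'.ker → E) (ρ : E → f'.ker), ContDiffAt ℝ 1 β 0 ∧ β 0 = a ∧
      HasFDerivAt β f'.ker.subtypeL 0 ∧ ContinuousAt ρ a ∧ ρ a = 0 ∧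
      (∀ᶠ k in 𝓝 0, f (β k) = f a) ∧ ∀ᶠ x in 𝓝 a, f x = f a → β (ρ x) = x := by
  have : CompleteSpace F := FiniteDimensional.complete ℝ F
  have hs : HasStrictFDerivAt f f' a := hf.hasStrictFDerivAt' hf' one_ne_zero
  have hr : f'.range = ⊤ := LinearMap.range_eq_top.2 hsurj
  have hk : f'.ker.ClosedComplemented :=
    ContinuousLinearMap.ker_closedComplemented_of_finiteDimensional_range f'
  set φ := HasStrictFDerivAt.implicitFunctionDataOfComplemented f f' hs hr hk with hφ
  have hpt : φ.pt = a := rfl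
  have hl : φ.leftFun = f := rfl
  have hρ : ContDiff ℝ 1 φ.rightFun :=
    (Classical.choose hk).contDiff.comp (contDiff_id.sub contDiff_const)
  have hρa : φ.rightFun a = 0 := by
    change Classical.choose hk (a - a) = 0
    simp
  have hprod : φ.prodFun φ.pt = (f a, 0) := by
    rw [φ.prodFun_apply, hpt, hρa, hl]
  have hC : ContDiffAt ℝ 1 φ.implicitFunction.uncurry (f a, 0) := by
    rw [← hprod]
    exact φ.contDiffAt_implicitFunction hf hρ.contDiffAt one_ne_zero
  have hmk : ContDiff ℝ 1 (fun k : f'.ker => (f a, k)) := contDiff_const.prodMk contDiff_id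
  refine ⟨φ.implicitFunction (f a), φ.rightFun, ?_, ?_, ?_, hρ.continuous.continuousAt, hρa, ?_, ?_⟩
  · exact ContDiffAt.comp (g := φ.implicitFunction.uncurry) (0 : f'.ker) hC hmk.contDiffAt
  · exact hs.implicitFunctionOfComplemented_apply_image hr hk
  · exact (hs.to_implicitFunctionOfComplemented hr hk).hasFDerivAt
  · have h1 := hs.map_implicitFunctionOfComplemented_eq hr hk
    have h2 : ContinuousAt (fun k : f'.ker => (f a, k)) 0 := hmk.continuous.continuousAt
    exact h2.eventually h1
  · filter_upwards [φ.implicitFunction_apply_image] with x hx hfx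
    rw [← hfx]
    exact hx

/-- If a map takes countably many values on the level sets of a submersion, then it is locally
constant on them. -/
theorem eventually_eq_of_countable {Y : Type*} [MetricSpace Y] {f : E → F} {f' : E →L[ℝ] F} {a : E}
    (hf : ContDiffAt ℝ 1 f a) (hf' : HasFDerivAt f f' a) (hsurj : Function.Surjective f')
    {g : E → Y} (hg : ∀ᶠ x in 𝓝 a, ContinuousAt g x) {S : Set Y} (hS : S.Countable)
    (hgS : ∀ᶠ x in 𝓝 a, f x = f a → g x ∈ S) : ∀ᶠ x in 𝓝 a, f x = f a → g x = g a := by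
  obtain ⟨β, ρ, hβ, hβ₀, -, hρ, hρ₀, hfβ, hβρ⟩ := exists_levelSet_param hf hf' hsurj
  have hβc : ∀ᶠ k in 𝓝 0, ContinuousAt β k :=
    (hβ.eventually (by simp)).mono fun _ h => h.continuousAt
  have ht : Filter.Tendsto β (𝓝 0) (𝓝 a) := by
    have := hβ.continuousAt.tendsto
    rwa [hβ₀] at this
  obtain ⟨ε, hε, H⟩ := Metric.eventually_nhds_iff_ball.1
    (hβc.and (hfβ.and ((ht.eventually hg).and (ht.eventually hgS))))
  have hρt : Filter.Tendsto ρ (𝓝 a) (𝓝 0) := by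
    have := hρ.tendsto
    rwa [hρ₀] at this
  -- A countable subset of a metric space is totally disconnected, whereas the image of a ball is
  -- connected.
  have hsub : ((fun k => g (β k)) '' Metric.ball 0 ε).Subsingleton := by
    have hc : ((fun k => g (β k)) '' Metric.ball 0 ε) ⊆ S := by
      rintro _ ⟨k, hk, rfl⟩
      exact (H k hk).2.2.2 (H k hk).2.1
    refine (hS.mono hc).isTotallyDisconnected _ subset_rfl ?_
    refine (convex_ball _ _).isPreconnected.image _ fun k hk => ?_
    exact (ContinuousAt.comp (g := g) (H k hk).2.2.1 (H k hk).1).continuousWithinAt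
  filter_upwards [hβρ, hρt (Metric.ball_mem_nhds 0 hε)] with x hx hxb hfx
  have := hsub (mem_image_of_mem _ hxb) (mem_image_of_mem _ (Metric.mem_ball_self hε))
  simpa [hx hfx, hβ₀] using this

/-- If the derivative of `g` vanishes on the kernel of the derivative of a submersion `f`,
then `g` is locally constant on the level sets of `f`. -/
theorem eventually_eq_of_ker_le {f : E → F} {a : E}
    (hf : ContDiffAt ℝ 1 f a) (hsurj : Function.Surjective (fderiv ℝ f a))
    {g : E → G} (hg : ∀ᶠ x in 𝓝 a, DifferentiableAt ℝ g x)
    (hker : ∀ᶠ x in 𝓝 a, ∀ v, fderiv ℝ f x v = 0 → fderiv ℝ g x v = 0) :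
    ∀ᶠ x in 𝓝 a, f x = f a → g x = g a := by
  obtain ⟨β, ρ, hβ, hβ₀, -, hρ, hρ₀, hfβ, hβρ⟩ :=
    exists_levelSet_param hf (hf.differentiableAt one_ne_zero).hasFDerivAt hsurj
  have ht : Filter.Tendsto β (𝓝 0) (𝓝 a) := by
    have := hβ.continuousAt.tendsto
    rwa [hβ₀] at this
  have hρt : Filter.Tendsto ρ (𝓝 a) (𝓝 0) := by
    have := hρ.tendsto
    rwa [hρ₀] at this
  have hfd : ∀ᶠ x in 𝓝 a, DifferentiableAt ℝ f x :=
    (hf.eventually (by simp)).mono fun _ h => h.differentiableAt one_ne_zero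
  have hz : ∀ᶠ k in 𝓝 0, HasFDerivAt (𝕜 := ℝ) (fun k => g (β k)) 0 k := by
    filter_upwards [hβ.eventually (by simp), hfβ.eventually_nhds, ht.eventually hg,
      ht.eventually hker, ht.eventually hfd] with k hk hfk hgk hkerk hfdk
    have hβk := (hk.differentiableAt one_ne_zero).hasFDerivAt
    have h1 : HasFDerivAt (fun k => f (β k)) _ k :=
      HasFDerivAt.comp (g := f) k hfdk.hasFDerivAt hβk
    have h2 : HasFDerivAt (𝕜 := ℝ) (fun k => f (β k)) 0 k :=
      (hasFDerivAt_const (f a) k).congr_of_eventuallyEq hfk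
    have h3 : HasFDerivAt (fun k => g (β k)) _ k :=
      HasFDerivAt.comp (g := g) k hgk.hasFDerivAt hβk
    convert! h3 using 1
    ext1 v
    refine (hkerk _ ?_).symm
    exact congrArg (fun M => M v) (h1.unique h2)
  filter_upwards [hβρ, hρt.eventually (eventually_eq_of_hasFDerivAt_zero hz)] with x hx hxb hfx
  simpa [hx hfx, hβ₀] using hxb

/-- If `g` is constant on the level set of a submersion `f` through `a`, then its derivative at `a`
vanishes on the kernel of the derivative of `f`. -/
theorem ker_le_of_eventually_eq {f : E → F} {f' : E →L[ℝ] F} {a : E} (hf : ContDiffAt ℝ 1 f a)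
    (hf' : HasFDerivAt f f' a) (hsurj : Function.Surjective f') {g : E → G} {g' : E →L[ℝ] G}
    (hg' : HasFDerivAt g g' a) (h : ∀ᶠ x in 𝓝 a, f x = f a → g x = g a) {v : E} (hv : f' v = 0) :
    g' v = 0 := by
  obtain ⟨β, ρ, hβ, hβ₀, hβ', -, -, hfβ, -⟩ := exists_levelSet_param hf hf' hsurj
  have ht : Filter.Tendsto β (𝓝 0) (𝓝 a) := by
    have := hβ.continuousAt.tendsto
    rwa [hβ₀] at this
  rw [← hβ₀] at hg'
  have h1 : HasFDerivAt (fun k => g (β k)) _ 0 := HasFDerivAt.comp (g := g) 0 hg' hβ'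
  have h2 : HasFDerivAt (𝕜 := ℝ) (fun k => g (β k)) 0 0 := by
    refine (hasFDerivAt_const (g a) 0).congr_of_eventuallyEq ?_
    filter_upwards [hfβ, ht.eventually h] with k hk hk'
    exact hk' hk
  exact congrArg (fun M => M ⟨v, hv⟩) (h1.unique h2)

/-- Let `h` be a map into the source of a submersion `Φ`.  If `Φ ∘ h` is locally constant on the
level sets of a submersion `f`, and the tangent space of the level set of `f` is mapped onto that of
`Φ`, then `h` is locally onto the level set of `Φ`. -/
theorem eventually_mem_range_of_levelSet {E₂ : Type*} [NormedAddCommGroup E₂] [NormedSpace ℝ E₂]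
    [FiniteDimensional ℝ E₂] [FiniteDimensional ℝ G] {p : E} {h : E → E₂} {h' : E →L[ℝ] E₂}
    (hh : HasStrictFDerivAt h h' p) {Φ : E₂ → G} {Φ' : E₂ →L[ℝ] G}
    (hΦ : HasStrictFDerivAt Φ Φ' (h p)) (hΦ' : Function.Surjective Φ')
    {f : E → F} {f' : E →L[ℝ] F} (hf : HasStrictFDerivAt f f' p) (hf' : Function.Surjective f')
    (hconst : ∀ᶠ q in 𝓝 p, f q = f p → Φ (h q) = Φ (h p))
    (hker : ∀ w, Φ' w = 0 → ∃ u, f' u = 0 ∧ h' u = w) {N : Set E} (hN : N ∈ 𝓝 p) :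
    ∀ᶠ w in 𝓝 (h p), Φ w = Φ (h p) → ∃ q ∈ N, h q = w := by
  have : CompleteSpace E₂ := FiniteDimensional.complete ℝ E₂
  have : CompleteSpace F := FiniteDimensional.complete ℝ F
  -- With a projection `π` onto `ker Φ'`, the map `w ↦ (Φ w, π w)` is a local coordinate system at
  -- `h p`. It remains to hit prescribed coordinates.
  obtain ⟨π, hπ⟩ : Φ'.ker.ClosedComplemented :=
    ContinuousLinearMap.ker_closedComplemented_of_finiteDimensional_range Φ'
  have heinj : Function.Injective (Φ'.prod π) := by
    rw [injective_iff_map_eq_zero]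
    intro w hw
    have h1 : Φ' w = 0 := congrArg Prod.fst hw
    have h2 : π w = 0 := congrArg Prod.snd hw
    have h3 := hπ ⟨w, h1⟩
    rw [h2] at h3
    exact (congrArg Subtype.val h3).symm
  have hesurj : Function.Surjective (Φ'.prod π) := by
    rintro ⟨c, k⟩
    obtain ⟨w, rfl⟩ := hΦ' c
    refine ⟨w + ((k - π w : Φ'.ker) : E₂), ?_⟩
    have hk : Φ' ((k - π w : Φ'.ker) : E₂) = 0 := (k - π w : Φ'.ker).2
    refine Prod.ext ?_ ?_
    · change Φ' (w + _) = Φ' w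
      rw [map_add, hk, add_zero]
    · change π (w + _) = k
      rw [map_add, hπ, add_sub_cancel]
  let e := ContinuousLinearEquiv.ofBijective (Φ'.prod π) (LinearMap.ker_eq_bot.2 heinj)
    (LinearMap.range_eq_top.2 hesurj)
  have hestrict : HasStrictFDerivAt (fun w => (Φ w, π w)) (e : E₂ →L[ℝ] G × Φ'.ker) (h p) :=
    hΦ.prodMk π.hasStrictFDerivAt
  have hinj : ∀ᶠ z in 𝓝 (h p, h p), (Φ z.1, π z.1) = (Φ z.2, π z.2) → z.1 = z.2 := by
    filter_upwards [prod_mem_nhds hestrict.eventually_left_inverse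
      hestrict.eventually_left_inverse] with z hz hz'
    rw [← hz.1, ← hz.2, hz']
  have hstrict : HasStrictFDerivAt (fun q => (f q, π (h q))) (f'.prod (π ∘L h')) p :=
    hf.prodMk (π.hasStrictFDerivAt.comp p hh)
  have hrange : (f'.prod (π ∘L h')).range = ⊤ := by
    refine LinearMap.range_eq_top.2 ?_
    rintro ⟨c, k⟩
    obtain ⟨u, rfl⟩ := hf' c
    obtain ⟨u', hu', hu''⟩ := hker ((k - π (h' u) : Φ'.ker) : E₂) (k - π (h' u) : Φ'.ker).2
    refine ⟨u + u', Prod.ext ?_ ?_⟩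
    · change f' (u + u') = f' u
      rw [map_add, hu', add_zero]
    · change π (h' (u + u')) = k
      rw [map_add, map_add, hu'', hπ, add_sub_cancel]
  -- The map `q ↦ (f q, π (h q))` is open at `p`. So for `w` near `h p` some `q` near `p` has `f q =
  -- f p` and `π (h q) = π w`; constancy on the level set supplies `Φ (h q) = Φ w`, and the
  -- coordinates of `h q` and `w` agree.
  have hnhds := hstrict.map_nhds_eq_of_surj hrange
  obtain ⟨N₁, hN₁, N₂, hN₂, H⟩ := mem_nhds_prod_iff.1 hinj
  have hgood : N ∩ {q | f q = f p → Φ (h q) = Φ (h p)} ∩ h ⁻¹' N₁ ∈ 𝓝 p :=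
    Filter.inter_mem (Filter.inter_mem hN hconst) (hh.continuousAt.preimage_mem_nhds hN₁)
  have himg := Filter.image_mem_map (m := fun q => (f q, π (h q))) hgood
  rw [hnhds] at himg
  have hcont : ContinuousAt (fun w => (f p, π w)) (h p) := by fun_prop
  filter_upwards [hN₂, hcont.preimage_mem_nhds himg] with w hw hw' hΦw
  obtain ⟨q, ⟨⟨hqN, hq⟩, hq₁⟩, hqw⟩ := hw'
  obtain ⟨h1, h2⟩ := Prod.mk.inj hqw
  refine ⟨q, hqN, ?_⟩
  refine H (show (h q, w) ∈ N₁ ×ˢ N₂ from ⟨hq₁, hw⟩) ?_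
  exact Prod.ext ((hq h1).trans hΦw.symm) h2

end Calculus

/-! ### Straightening commuting vector fields -/

section Frobenius

variable {A : Type*} [NormedAddCommGroup A] [NormedSpace ℝ A] [CompleteSpace A]
  {E : Type*} [NormedAddCommGroup E] [NormedSpace ℝ E] [FiniteDimensional ℝ E]
  {F : Type*} [NormedAddCommGroup F] [NormedSpace ℝ F] [FiniteDimensional ℝ F]
  {T : E → A →L[ℝ] E}

/-- The joint flow for fields that are only defined near a point. -/
theorem exists_jointFlow_of_contDiffAt {x₀ : E} (hT : ContDiffAt ℝ 1 T x₀)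
    (hcomm : ∀ᶠ x in 𝓝 x₀, ∀ u v, fderiv ℝ T x (T x u) v = fderiv ℝ T x (T x v) u) :
    ∃ α : A × E → E, ContDiffAt ℝ 1 α (0, x₀) ∧ (∀ᶠ b in 𝓝 x₀, α (0, b) = b) ∧
      ∀ᶠ p in 𝓝 ((0 : A), x₀), ∀ u, fderiv ℝ α p (u, 0) = T (α p) u := by
  have : CompleteSpace E := FiniteDimensional.complete ℝ E
  obtain ⟨r, hr, H⟩ := Metric.eventually_nhds_iff_ball.1 (hT.eventually (by simp))
  -- The outer radius `r / 2` keeps the support inside the ball where `T` is `C¹`. The cut-off field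
  -- has the same germ at `x₀`, and commutation is needed only there.
  let χ : ContDiffBump x₀ := ⟨r / 3, r / 2, by positivity, by linarith⟩
  let T₁ : E → A →L[ℝ] E := fun x => χ x • T x
  have hT₁ : ContDiff ℝ 1 T₁ := by
    rw [contDiff_iff_contDiffAt]
    intro x
    by_cases hx : x ∈ Metric.ball x₀ r
    · exact χ.contDiff.contDiffAt.smul (H x hx)
    · have hx' : x ∉ tsupport χ := by
        rw [χ.tsupport_eq]
        intro hx'
        rw [Metric.mem_closedBall] at hx'
        rw [Metric.mem_ball, not_lt] at hx
        have : χ.rOut = r / 2 := rfl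
        linarith
      have h0 : T₁ =ᶠ[𝓝 x] fun _ => (0 : A →L[ℝ] E) := by
        filter_upwards [notMem_tsupport_iff_eventuallyEq.1 hx'] with y hy
        simp [T₁, hy]
      exact (contDiffAt_const (𝕜 := ℝ)).congr_of_eventuallyEq h0
  have heq : T₁ =ᶠ[𝓝 x₀] T := by
    filter_upwards [χ.eventuallyEq_one] with x hx
    simp [T₁, hx]
  have hcomm₁ : ∀ᶠ x in 𝓝 x₀, ∀ u v,
      fderiv ℝ T₁ x (T₁ x u) v = fderiv ℝ T₁ x (T₁ x v) u := by
    filter_upwards [hcomm, heq, heq.fderiv (𝕜 := ℝ)] with x hx h1 h2 u v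
    rw [h1, h2, hx]
  obtain ⟨α, hα, hα₀, hα'⟩ := exists_jointFlow hT₁ hcomm₁
  refine ⟨α, hα, hα₀, ?_⟩
  have ht : Filter.Tendsto α (𝓝 (0, x₀)) (𝓝 x₀) := by
    have := hα.continuousAt.tendsto
    rwa [hα₀.self_of_nhds] at this
  filter_upwards [hα', ht.eventually heq] with p hp hp' u
  rw [hp, hp']

/-- Commuting vector fields that are linearly independent at a point are locally the kernel of the
derivative of a submersion. -/
theorem exists_straightening {x₀ : E} (hT : ContDiffAt ℝ 1 T x₀)
    (hcomm : ∀ᶠ x in 𝓝 x₀, ∀ u v, fderiv ℝ T x (T x u) v = fderiv ℝ T x (T x v) u)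
    (hinj : Function.Injective (T x₀)) {π : E →L[ℝ] F} (hπ : Function.Surjective π)
    (hker : ∀ v, π v = 0 ↔ ∃ u, T x₀ u = v) :
    ∃ t : E → F, ContDiffAt ℝ 1 t x₀ ∧ ∀ᶠ x in 𝓝 x₀,
      Function.Surjective (fderiv ℝ t x) ∧ ∀ v, fderiv ℝ t x v = 0 ↔ ∃ u, T x u = v := by
  have : CompleteSpace E := FiniteDimensional.complete ℝ E
  have : CompleteSpace F := FiniteDimensional.complete ℝ F
  obtain ⟨α, hα, hα₀, hα'⟩ := exists_jointFlow_of_contDiffAt hT hcomm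
  obtain ⟨s₀, hs₀⟩ := LinearMap.exists_rightInverse_of_surjective π.toLinearMap
    (LinearMap.range_eq_top.2 hπ)
  let s : F →L[ℝ] E := LinearMap.toContinuousLinearMap s₀
  have hs : ∀ c, π (s c) = c := fun c => congrArg (fun M => M c) hs₀
  -- The affine slice `x₀ + s c` is transverse to the range of `T x₀`. Flowing it along the fields
  -- gives the chart `Θ (u, c)`, whose slice coordinate `c` will be the submersion.
  let ι : A × F → A × E := fun q => (q.1, x₀ + s q.2)
  have hι : ContDiff ℝ 1 ι :=
    contDiff_fst.prodMk (contDiff_const.add (s.contDiff.comp contDiff_snd))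
  have hι₀ : ι 0 = (0, x₀) := by simp [ι]
  have hιd : ∀ q, HasFDerivAt ι ((ContinuousLinearMap.fst ℝ A F).prod
      (s ∘L ContinuousLinearMap.snd ℝ A F)) q := fun q =>
    hasFDerivAt_fst.prodMk ((s.hasFDerivAt.comp q hasFDerivAt_snd).const_add x₀)
  let Θ : A × F → E := fun q => α (ι q)
  have hΘ₀ : Θ 0 = x₀ := by simp [Θ, hι₀, hα₀.self_of_nhds]
  have hΘ : ContDiffAt ℝ 1 Θ 0 := by
    have : ContDiffAt ℝ 1 α (ι 0) := by rwa [hι₀]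
    exact ContDiffAt.comp (g := α) 0 this hι.contDiffAt
  have htι : Filter.Tendsto ι (𝓝 0) (𝓝 (0, x₀)) := by
    have := hι.continuous.tendsto 0
    rwa [hι₀] at this
  have hΘu : ∀ᶠ q in 𝓝 0, ∀ u, fderiv ℝ Θ q (u, 0) = T (Θ q) u := by
    filter_upwards [htι.eventually hα', htι.eventually (hα.eventually (by simp))] with q hq hq' u
    have h1 : HasFDerivAt Θ _ q := HasFDerivAt.comp (g := α) q
      (hq'.differentiableAt one_ne_zero).hasFDerivAt (hιd q)
    rw [h1.fderiv, ← hq u]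
    simp
  have hΘc : ∀ c, fderiv ℝ Θ 0 (0, c) = s c := by
    intro c
    have h1 : HasFDerivAt (fun c : F => Θ (0, c)) _ 0 :=
      HasFDerivAt.comp (g := Θ) (0 : F) (hΘ.differentiableAt one_ne_zero).hasFDerivAt
        (hasFDerivAt_prodMk_right (0 : A) (0 : F))
    have h2 : HasFDerivAt (fun c : F => Θ (0, c)) s 0 := by
      refine (s.hasFDerivAt.const_add x₀).congr_of_eventuallyEq ?_
      have : Filter.Tendsto (fun c => x₀ + s c) (𝓝 0) (𝓝 x₀) := by
        have : Continuous fun c => x₀ + s c := by fun_prop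
        simpa using this.tendsto 0
      exact this.eventually hα₀
    exact congrArg (fun M => M c) (h1.unique h2)
  have hΘ' : ∀ u c, fderiv ℝ Θ 0 (u, c) = T x₀ u + s c := by
    intro u c
    have : ((u, c) : A × F) = (u, 0) + (0, c) := by simp
    rw [this, map_add, hΘc, hΘu.self_of_nhds, hΘ₀]
  have hbinj : Function.Injective (fderiv ℝ Θ 0) := by
    rw [injective_iff_map_eq_zero]
    rintro ⟨u, c⟩ h
    rw [hΘ'] at h
    have hc : c = 0 := by
      have := congrArg π h
      rwa [map_add, (hker _).2 ⟨u, rfl⟩, hs, zero_add, map_zero] at this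
    rw [hc, map_zero, add_zero, ← map_zero (T x₀)] at h
    rw [hinj h, hc]; rfl
  have hbsurj : Function.Surjective (fderiv ℝ Θ 0) := by
    intro v
    obtain ⟨u, hu⟩ := (hker (v - s (π v))).1 (by rw [map_sub, hs, sub_self])
    exact ⟨(u, π v), by rw [hΘ', hu, sub_add_cancel]⟩
  let e := ContinuousLinearEquiv.ofBijective (fderiv ℝ Θ 0) (LinearMap.ker_eq_bot.2 hbinj)
    (LinearMap.range_eq_top.2 hbsurj)
  have he : HasFDerivAt Θ (e : A × F →L[ℝ] E) 0 := (hΘ.differentiableAt one_ne_zero).hasFDerivAt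
  have hes : HasStrictFDerivAt Θ (e : A × F →L[ℝ] E) 0 := hΘ.hasStrictFDerivAt' he one_ne_zero
  set g : E → A × F := hes.localInverse Θ e 0 with hgdef
  have hg : ContDiffAt ℝ 1 g x₀ := by
    have := hΘ.to_localInverse he one_ne_zero
    rw [hΘ₀] at this
    exact this
  have hg₀ : g x₀ = 0 := by
    have := hes.localInverse_apply_image
    rwa [hΘ₀] at this
  have hΘg : ∀ᶠ x in 𝓝 x₀, Θ (g x) = x := by
    have := hes.eventually_right_inverse
    rwa [hΘ₀] at this
  have hgΘ : ∀ᶠ q in 𝓝 0, g (Θ q) = q := hes.eventually_left_inverse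
  have htg : Filter.Tendsto g (𝓝 x₀) (𝓝 0) := by
    have := hg.continuousAt.tendsto
    rwa [hg₀] at this
  -- Since `fderiv ℝ Θ` sends `(u, 0)` to `T u` at all nearby points, the vectors whose
  -- `c`-component under the inverse derivative vanishes are exactly the values of `T`.
  refine ⟨fun x => (g x).2, contDiff_snd.contDiffAt.comp _ hg, ?_⟩
  filter_upwards [hΘg.eventually_nhds, htg.eventually hgΘ.eventually_nhds,
    hg.eventually (by simp), htg.eventually (hΘ.eventually (by simp)), htg.eventually hΘu]
    with x h1 h2 h3 h4 h5
  have hx : Θ (g x) = x := h1.self_of_nhds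
  have dg := (h3.differentiableAt one_ne_zero).hasFDerivAt
  have dΘ := (h4.differentiableAt one_ne_zero).hasFDerivAt
  have c1 : ∀ v, fderiv ℝ Θ (g x) (fderiv ℝ g x v) = v := by
    intro v
    have a1 : HasFDerivAt (fun x => Θ (g x)) _ x := HasFDerivAt.comp (g := Θ) x dΘ dg
    have a2 : HasFDerivAt (fun x => Θ (g x)) (.id ℝ E) x :=
      (hasFDerivAt_id x).congr_of_eventuallyEq h1
    exact congrArg (fun M => M v) (a1.unique a2)
  have c2 : ∀ q, fderiv ℝ g x (fderiv ℝ Θ (g x) q) = q := by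
    intro q
    rw [← hx] at dg
    have a1 : HasFDerivAt (fun q => g (Θ q)) _ (g x) := HasFDerivAt.comp (g := g) (g x) dg dΘ
    have a2 : HasFDerivAt (fun q => g (Θ q)) (.id ℝ _) (g x) :=
      (hasFDerivAt_id (g x)).congr_of_eventuallyEq h2
    have := congrArg (fun M => M q) (a1.unique a2)
    simp only [ContinuousLinearMap.comp_apply, hx] at this
    exact this
  have ht : HasFDerivAt (fun x => (g x).2) (ContinuousLinearMap.snd ℝ A F ∘L fderiv ℝ g x) x :=
    hasFDerivAt_snd.comp x dg
  rw [ht.fderiv]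
  refine ⟨fun c => ⟨fderiv ℝ Θ (g x) (0, c), ?_⟩, fun v => ⟨fun hv => ?_, ?_⟩⟩
  · simp [c2]
  · refine ⟨(fderiv ℝ g x v).1, ?_⟩
    have hv' : fderiv ℝ g x v = ((fderiv ℝ g x v).1, 0) := Prod.ext rfl hv
    rw [← hx, ← h5, hx, ← hv', c1]
  · rintro ⟨u, rfl⟩
    have := c2 (u, 0)
    rw [h5, hx] at this
    simp [this]

end Frobenius

/-! ### Normalized frames and linear complements. -/

section Frames

variable {E : Type*} [NormedAddCommGroup E] [NormedSpace ℝ E] [FiniteDimensional ℝ E]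

/-- A frame of a distribution can be normalized so that a projection maps it to the standard
basis. -/
theorem exists_normalized_frame {r : ℕ} {W : Set E} (hW : IsOpen W) {y₀ : E} (hy₀ : y₀ ∈ W)
    {σ : Fin r → E → E} (hσ : ∀ i, ContDiffOn ℝ ∞ (σ i) W)
    (hr : finrank ℝ (Submodule.span ℝ (range fun i => σ i y₀)) = r) :
    ∃ W' ⊆ W, IsOpen W' ∧ y₀ ∈ W' ∧ ∃ (T : E → (Fin r → ℝ) →L[ℝ] E) (P : E →L[ℝ] (Fin r → ℝ)),
      ContDiffOn ℝ ∞ T W' ∧ (∀ y ∈ W', ∀ u, P (T y u) = u) ∧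
      ∀ y ∈ W', ∀ v, v ∈ Submodule.span ℝ (range fun i => σ i y) ↔ ∃ u, T y u = v := by
  have : CompleteSpace E := FiniteDimensional.complete ℝ E
  let S : E → (Fin r → ℝ) →L[ℝ] E := fun y =>
    ∑ i, (ContinuousLinearMap.proj i : (Fin r → ℝ) →L[ℝ] ℝ).smulRight (σ i y)
  have hS : ∀ y u, S y u = ∑ i, u i • σ i y := fun y u => by simp [S]
  have hSC : ContDiffOn ℝ ∞ S W := by
    refine ContDiffOn.sum fun i _ => ?_
    exact ((ContinuousLinearMap.smulRightL ℝ (Fin r → ℝ) E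
      (ContinuousLinearMap.proj i)).contDiff).comp_contDiffOn (hσ i)
  have hSrange : ∀ y v, v ∈ Submodule.span ℝ (range fun i => σ i y) ↔ ∃ u, S y u = v := by
    intro y v
    rw [Submodule.mem_span_range_iff_exists_fun]
    simp only [hS]
  have hli : LinearIndependent ℝ fun i => σ i y₀ := by
    rw [linearIndependent_iff_card_eq_finrank_span, Fintype.card_fin]
    exact hr.symm
  have hinj : Function.Injective (S y₀) := by
    rw [injective_iff_map_eq_zero]
    intro u hu
    rw [hS] at hu
    exact funext (Fintype.linearIndependent_iff.1 hli u hu)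
  obtain ⟨P₀, hP₀⟩ := LinearMap.exists_leftInverse_of_injective (S y₀).toLinearMap
    (LinearMap.ker_eq_bot.2 hinj)
  let P : E →L[ℝ] (Fin r → ℝ) := LinearMap.toContinuousLinearMap P₀
  -- This is the identity at `y₀`, hence invertible nearby. Composing the frame `S y` with its
  -- inverse keeps the span and makes `P` a left inverse.
  let M : E → (Fin r → ℝ) →L[ℝ] (Fin r → ℝ) := fun y => P ∘L S y
  have hM₀ : M y₀ = .id ℝ _ := by
    ext1 u
    exact congrArg (fun L => L u) hP₀
  have hMC : ContDiffOn ℝ ∞ M W := contDiffOn_const.clm_comp hSC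
  let O : Set ((Fin r → ℝ) →L[ℝ] (Fin r → ℝ)) :=
    range ((↑) : ((Fin r → ℝ) ≃L[ℝ] (Fin r → ℝ)) → _)
  have hO : IsOpen O := ContinuousLinearEquiv.isOpen
  refine ⟨W ∩ M ⁻¹' O, inter_subset_left, hMC.continuousOn.isOpen_inter_preimage hW hO,
    ⟨hy₀, .refl ℝ _, hM₀.symm⟩, fun y => S y ∘L (M y).inverse, P, ?_, ?_, ?_⟩
  · refine (hSC.mono inter_subset_left).clm_comp fun y hy => ?_
    obtain ⟨e, he⟩ := hy.2
    have h1 := contDiffAt_map_inverse (𝕜 := ℝ) (n := ∞) e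
    rw [he] at h1
    exact h1.comp_contDiffWithinAt y ((hMC.mono inter_subset_left) y hy)
  · rintro y ⟨-, e, he⟩ u
    change (M y) ((M y).inverse u) = u
    rw [← he, ContinuousLinearMap.inverse_equiv]
    exact e.apply_symm_apply u
  · rintro y ⟨-, e, he⟩ v
    rw [hSrange]
    constructor
    · rintro ⟨u, rfl⟩
      refine ⟨M y u, ?_⟩
      change S y ((M y).inverse (M y u)) = S y u
      rw [← he, ContinuousLinearMap.inverse_equiv]
      exact congrArg (S y) (e.symm_apply_apply u)
    · rintro ⟨u, rfl⟩
      exact ⟨_, rfl⟩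

/-- A linear surjection with prescribed kernel. -/
theorem exists_surjective_with_ker (R : Submodule ℝ E) {r : ℕ} (hr : finrank ℝ R = r) :
    ∃ π : E →L[ℝ] (Fin (finrank ℝ E - r) → ℝ), Function.Surjective π ∧
      ∀ v, π v = 0 ↔ v ∈ R := by
  have hd : finrank ℝ (E ⧸ R) = finrank ℝ (Fin (finrank ℝ E - r) → ℝ) := by
    rw [finrank_fin_fun, ← hr, Submodule.finrank_quotient]
  let e := LinearEquiv.ofFinrankEq _ _ hd
  refine ⟨LinearMap.toContinuousLinearMap (e.toLinearMap ∘ₗ R.mkQ), ?_, fun v => ?_⟩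
  · exact e.surjective.comp R.mkQ_surjective
  · change e (R.mkQ v) = 0 ↔ _
    rw [e.map_eq_zero_iff, Submodule.mkQ_apply, Submodule.Quotient.mk_eq_zero]

end Frames

/-! ### Frobenius' theorem on a manifold. -/

section FlowBox

variable {E : Type*} [NormedAddCommGroup E] [NormedSpace ℝ E] [FiniteDimensional ℝ E]
  {M : Type*} [TopologicalSpace M] [ChartedSpace E M] [IsManifold 𝓘(ℝ, E) ∞ M]

/-- The components of a smooth vector field in a chart are smooth. -/
theorem contDiffOn_vectorField_chart {X : ∀ x : M, TangentSpace 𝓘(ℝ, E) x} {U : Set M} {x₀ : M}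
    (hU₀ : IsOpen U) (hU : U ⊆ (extChartAt 𝓘(ℝ, E) x₀).source)
    (hX : ContMDiffOn 𝓘(ℝ, E) 𝓘(ℝ, E).tangent ∞
      (fun x => (⟨x, X x⟩ : TangentBundle 𝓘(ℝ, E) M)) U) :
    ContDiffOn ℝ ∞ (fun y => (mfderiv 𝓘(ℝ, E) 𝓘(ℝ, E) (extChartAt 𝓘(ℝ, E) x₀)
      ((extChartAt 𝓘(ℝ, E) x₀).symm y) (X ((extChartAt 𝓘(ℝ, E) x₀).symm y)) : E))
      ((extChartAt 𝓘(ℝ, E) x₀).target ∩ (extChartAt 𝓘(ℝ, E) x₀).symm ⁻¹' U) := by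
  set φ := extChartAt 𝓘(ℝ, E) x₀ with hφ
  have hbase : φ.source = (trivializationAt E (TangentSpace 𝓘(ℝ, E)) x₀).baseSet := by
    rw [hφ, extChartAt_source, TangentBundle.trivializationAt_baseSet]
  have h1 := ((trivializationAt E (TangentSpace 𝓘(ℝ, E) (M := M)) x₀).contMDiffOn_section_iff
    (IB := 𝓘(ℝ, E)) (n := ∞) (s := X) (a := U) hU₀ (hU.trans hbase.subset)).1 hX
  have h2 : ContMDiffOn 𝓘(ℝ, E) 𝓘(ℝ, E) ∞ φ.symm φ.target := contMDiffOn_extChartAt_symm x₀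
  have h3 := h1.comp (h2.mono inter_subset_left) (s := φ.target ∩ φ.symm ⁻¹' U)
    (fun y hy => hy.2)
  rw [contMDiffOn_iff_contDiffOn] at h3
  refine h3.congr fun y hy => ?_
  have hs : φ.symm y ∈ (chartAt E x₀).source := by
    rw [← extChartAt_source 𝓘(ℝ, E) x₀]
    exact hU hy.2
  have e1 := TangentBundle.continuousLinearMapAt_trivializationAt (I := 𝓘(ℝ, E)) hs
  have e2 : (trivializationAt E (TangentSpace 𝓘(ℝ, E)) x₀).continuousLinearMapAt ℝ (φ.symm y)
      (X (φ.symm y)) = (trivializationAt E (TangentSpace 𝓘(ℝ, E)) x₀ ⟨φ.symm y, X (φ.symm y)⟩).2 := by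
    rw [Bundle.Trivialization.continuousLinearMapAt_apply,
      Bundle.Trivialization.linearMapAt_apply, if_pos (hbase ▸ hU hy.2)]
  exact (congrArg (fun L => L (X (φ.symm y))) e1).symm.trans e2

theorem mlieBracket_vectorSpace (V W : E → E) (y : E) :
    VectorField.mlieBracket 𝓘(ℝ, E) (M := E) V W y = VectorField.lieBracket ℝ V W y := by
  have := congrFun (VectorField.mlieBracketWithin_eq_lieBracketWithin (𝕜 := ℝ) (E := E)
    (V := V) (W := W) (s := univ)) y
  exact (congrFun (VectorField.mlieBracketWithin_univ (I := 𝓘(ℝ, E)) (V := V) (W := W)).symm y).trans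
    (this.trans (congrFun VectorField.lieBracketWithin_univ y))

/-- **Frobenius' theorem**: an involutive distribution is locally the kernel of the derivative of
a submersion. -/
theorem exists_flowBox {Δ : ∀ x : M, Submodule ℝ (TangentSpace 𝓘(ℝ, E) x)} {r : ℕ}
    (hΔ : IsDistribution Δ r) (hinv : IsInvolutive Δ) (x₀ : M) :
    ∃ U : Set M, IsOpen U ∧ x₀ ∈ U ∧ ∃ t : M → (Fin (finrank ℝ E - r) → ℝ), ∀ x ∈ U,
      ContMDiffAt 𝓘(ℝ, E) 𝓘(ℝ, Fin (finrank ℝ E - r) → ℝ) 1 t x ∧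
      Function.Surjective (dmap E (Fin (finrank ℝ E - r) → ℝ) t x) ∧
      ∀ v, dmap E (Fin (finrank ℝ E - r) → ℝ) t x v = 0 ↔ v ∈ Δ x := by
  have : CompleteSpace E := FiniteDimensional.complete ℝ E
  have : IsManifold 𝓘(ℝ, E) (minSmoothness ℝ 2) M := by
    rw [minSmoothness_of_isRCLikeNormedField]; infer_instance
  obtain ⟨hrank, hloc⟩ := hΔ
  obtain ⟨U₀, hU₀, hxU₀, s, hs, hspan⟩ := hloc x₀
  set φ := extChartAt 𝓘(ℝ, E) x₀ with hφ
  set y₀ := φ x₀ with hy₀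
  have hx₀ : x₀ ∈ φ.source := mem_extChartAt_source x₀
  have hsrc : IsOpen φ.source := isOpen_extChartAt_source x₀
  have htgt : IsOpen φ.target := isOpen_extChartAt_target x₀
  set U₁ := U₀ ∩ φ.source with hU₁
  have hcsymm : ContinuousOn φ.symm φ.target := continuousOn_extChartAt_symm x₀
  have hW : IsOpen (φ.target ∩ φ.symm ⁻¹' U₁) :=
    hcsymm.isOpen_inter_preimage htgt (hU₀.inter hsrc)
  have hleft : ∀ x ∈ φ.source, φ.symm (φ x) = x := fun x hx => φ.left_inv hx
  have hφinv : ∀ x ∈ φ.source, (mfderiv 𝓘(ℝ, E) 𝓘(ℝ, E) φ x).IsInvertible := fun x hx =>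
    isInvertible_mfderiv_extChartAt hx
  have hφC : ∀ x ∈ φ.source, ContMDiffAt 𝓘(ℝ, E) 𝓘(ℝ, E) ∞ φ x := fun x hx =>
    contMDiffAt_extChartAt' (by rwa [hφ, extChartAt_source] at hx)
  have hφd : ∀ x ∈ φ.source, MDifferentiableAt 𝓘(ℝ, E) 𝓘(ℝ, E) φ x := fun x hx =>
    (hφC x hx).mdifferentiableAt (by simp)
  have hymem : y₀ ∈ φ.target ∩ φ.symm ⁻¹' U₁ := by
    refine ⟨φ.map_source hx₀, ?_⟩
    rw [mem_preimage, hy₀, hleft x₀ hx₀]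
    exact ⟨hxU₀, hx₀⟩
  let σ : Fin r → E → E := fun i y => mfderiv 𝓘(ℝ, E) 𝓘(ℝ, E) φ (φ.symm y) (s i (φ.symm y))
  have hσ : ∀ i, ContDiffOn ℝ ∞ (σ i) (φ.target ∩ φ.symm ⁻¹' U₁) := fun i =>
    contDiffOn_vectorField_chart (hU₀.inter hsrc) inter_subset_right ((hs i).mono inter_subset_left)
  have hσφ : ∀ x ∈ φ.source, ∀ i, σ i (φ x) = mfderiv 𝓘(ℝ, E) 𝓘(ℝ, E) φ x (s i x) := by
    intro x hx i
    simp only [σ]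
    rw [hleft x hx]
  have hσspan : ∀ x ∈ U₁, Submodule.span ℝ (range fun i => σ i (φ x)) =
      (Δ x).map (mfderiv 𝓘(ℝ, E) 𝓘(ℝ, E) φ x).toLinearMap := by
    intro x hx
    rw [hspan x hx.1, Submodule.map_span, ← range_comp]
    congr 2
    funext i
    exact hσφ x hx.2 i
  have hrank₀ : finrank ℝ (Submodule.span ℝ (range fun i => σ i y₀)) = r := by
    rw [hy₀, hσspan x₀ ⟨hxU₀, hx₀⟩]
    refine Eq.trans ?_ (hrank x₀)
    exact (LinearEquiv.finrank_eq (Submodule.equivMapOfInjective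
      (mfderiv 𝓘(ℝ, E) 𝓘(ℝ, E) φ x₀).toLinearMap (hφinv x₀ hx₀).injective (Δ x₀))).symm
  obtain ⟨W', hW', hW'o, hyW', T, P, hT, hPT, hTspan⟩ :=
    exists_normalized_frame hW hymem hσ hrank₀
  have hφW : ∀ x ∈ φ.source, φ x ∈ W' → x ∈ U₁ := by
    intro x hx hxW
    have := (hW' hxW).2
    rwa [mem_preimage, hleft x hx] at this
  have hmem : ∀ x ∈ φ.source, φ x ∈ W' → ∀ v : TangentSpace 𝓘(ℝ, E) x,
      (∃ u, T (φ x) u = (mfderiv 𝓘(ℝ, E) 𝓘(ℝ, E) φ x v : E)) ↔ v ∈ Δ x := by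
    intro x hx hxW v
    refine ((hTspan _ hxW _).symm.trans (Eq.to_iff (congrArg (fun R : Submodule ℝ E =>
      (mfderiv 𝓘(ℝ, E) 𝓘(ℝ, E) φ x v : E) ∈ R) (hσspan x (hφW x hx hxW))))).trans ?_
    exact (hφinv x hx).injective.mem_set_image (s := (Δ x : Set (TangentSpace 𝓘(ℝ, E) x)))
  let U₂ : Set M := φ.source ∩ φ ⁻¹' W'
  have hU₂ : IsOpen U₂ := (continuousOn_extChartAt x₀).isOpen_inter_preimage hsrc hW'o
  -- Involutivity is a condition on fields on `M`, so the normalized frame is pulled back from the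
  -- chart, and the bracket is carried over again by naturality.
  let X : (Fin r → ℝ) → ∀ x : M, TangentSpace 𝓘(ℝ, E) x := fun u =>
    VectorField.mpullback 𝓘(ℝ, E) 𝓘(ℝ, E) φ (fun y => (T y u : E))
  have hTu : ∀ u, ∀ y ∈ W', ContDiffAt ℝ ∞ (fun y => T y u) y := fun u y hy =>
    (hT.contDiffAt (hW'o.mem_nhds hy)).clm_apply contDiffAt_const
  have hTm : ∀ u, ∀ y ∈ W', ContMDiffAt 𝓘(ℝ, E) 𝓘(ℝ, E).tangent ∞
      (fun y => (⟨y, T y u⟩ : TangentBundle 𝓘(ℝ, E) E)) y := fun u y hy =>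
    contMDiffAt_vectorSpace_iff_contDiffAt.2 (hTu u y hy)
  have hXC : ∀ u, ContMDiffOn 𝓘(ℝ, E) 𝓘(ℝ, E).tangent ∞
      (fun x => (⟨x, X u x⟩ : TangentBundle 𝓘(ℝ, E) M)) U₂ := fun u x hx =>
    (ContMDiffAt.mpullback_vectorField_preimage (hTm u _ hx.2) (hφC x hx.1) (hφinv x hx.1)
      (by simp)).contMDiffWithinAt
  have hXφ : ∀ u, ∀ x ∈ φ.source, mfderiv 𝓘(ℝ, E) 𝓘(ℝ, E) φ x (X u x) = T (φ x) u := by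
    intro u x hx
    exact (hφinv x hx).self_apply_inverse _
  have hXΔ : ∀ u, ∀ x ∈ U₂, X u x ∈ Δ x := fun u x hx =>
    (hmem x hx.1 hx.2 _).1 ⟨u, (hXφ u x hx.1).symm⟩
  have hbracket : ∀ u v, ∀ x ∈ U₂, ∃ w, T (φ x) w =
      VectorField.lieBracket ℝ (fun y => T y u) (fun y => T y v) (φ x) := by
    intro u v x hx
    have h1 := hinv U₂ hU₂ (X u) (X v) (hXC u) (hXC v) (hXΔ u) (hXΔ v) x hx
    obtain ⟨w, hw⟩ := (hmem x hx.1 hx.2 _).2 h1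
    refine ⟨w, hw.trans ?_⟩
    have h2 := VectorField.mpullback_mlieBracket (n := ∞)
      ((hTm u _ hx.2).mdifferentiableAt (by simp)) ((hTm v _ hx.2).mdifferentiableAt (by simp))
      (hφC x hx.1) (by rw [minSmoothness_of_isRCLikeNormedField]; exact ENat.LEInfty.out)
    rw [← h2]
    exact ((hφinv x hx.1).self_apply_inverse _).trans (mlieBracket_vectorSpace _ _ _)
  have hTd : ∀ y ∈ W', DifferentiableAt ℝ T y := fun y hy =>
    (hT.contDiffAt (hW'o.mem_nhds hy)).differentiableAt (by simp)
  have hcomm : ∀ x ∈ U₂, ∀ u v,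
      fderiv ℝ T (φ x) (T (φ x) u) v = fderiv ℝ T (φ x) (T (φ x) v) u := by
    intro x hx u v
    have hd : ∀ u, HasFDerivAt (fun y => T y u) ((fderiv ℝ T (φ x)).flip u) (φ x) := by
      intro u
      convert! (hTd _ hx.2).hasFDerivAt.clm_apply (hasFDerivAt_const u (φ x)) using 1
      simp
    -- As `P (T y u) = u` does not depend on `y`, `P` kills all derivatives of the fields and so
    -- their brackets. But a bracket has the form `T w` with `w = P (T w)`, so it vanishes: the
    -- normalized frame commutes.
    have hPd : ∀ u w, P (fderiv ℝ T (φ x) w u) = 0 := by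
      intro u w
      have h1 : HasFDerivAt (fun y => P (T y u)) _ (φ x) := P.hasFDerivAt.comp _ (hd u)
      have h2 : HasFDerivAt (𝕜 := ℝ) (fun y => P (T y u)) 0 (φ x) := by
        refine (hasFDerivAt_const u _).congr_of_eventuallyEq ?_
        filter_upwards [hW'o.mem_nhds hx.2] with y hy using hPT y hy u
      exact congrArg (fun L => L w) (h1.unique h2)
    obtain ⟨w, hw⟩ := hbracket u v x hx
    rw [VectorField.lieBracket_eq] at hw
    simp only [(hd _).fderiv, ContinuousLinearMap.flip_apply] at hw
    have hw0 : w = 0 := by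
      rw [← hPT _ hx.2 w, hw, map_sub, hPd, hPd, sub_zero]
    rw [hw0, map_zero] at hw
    exact sub_eq_zero.1 hw.symm
  have hcomm' : ∀ y ∈ W', ∀ u v, fderiv ℝ T y (T y u) v = fderiv ℝ T y (T y v) u := by
    intro y hy
    have h1 : φ (φ.symm y) = y := φ.right_inv (hW' hy).1
    have := hcomm (φ.symm y) ⟨φ.map_target (hW' hy).1, by rwa [mem_preimage, h1]⟩
    rwa [h1] at this
  have hTinj : Function.Injective (T y₀) := Function.LeftInverse.injective (hPT y₀ hyW')
  obtain ⟨π, hπ, hπker⟩ := exists_surjective_with_ker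
    (Submodule.span ℝ (range fun i => σ i y₀)) hrank₀
  obtain ⟨t, ht, ht'⟩ := exists_straightening
    ((hT.contDiffAt (hW'o.mem_nhds hyW')).of_le (by simp))
    (Filter.mem_of_superset (hW'o.mem_nhds hyW') hcomm') hTinj hπ
    (fun v => (hπker v).trans (hTspan y₀ hyW' v))
  obtain ⟨O, hO, hOo, hyO⟩ := mem_nhds_iff.1
    ((ht.eventually (by simp)).and (ht'.and (hW'o.mem_nhds hyW')))
  refine ⟨φ.source ∩ φ ⁻¹' O, (continuousOn_extChartAt x₀).isOpen_inter_preimage hsrc hOo,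
    ⟨hx₀, hyO⟩, fun x => t (φ x), ?_⟩
  rintro x ⟨hx, hxO⟩
  obtain ⟨h1, ⟨h2, h3⟩, h4⟩ := hO hxO
  have hd : mfderiv 𝓘(ℝ, E) 𝓘(ℝ, Fin (finrank ℝ E - r) → ℝ) (fun x => t (φ x)) x =
      (fderiv ℝ t (φ x)).comp (mfderiv 𝓘(ℝ, E) 𝓘(ℝ, E) φ x) := by
    rw [← mfderiv_eq_fderiv]
    exact mfderiv_comp x (h1.differentiableAt one_ne_zero).mdifferentiableAt (hφd x hx)
  refine ⟨ContMDiffAt.comp x h1.contMDiffAt ((hφC x hx).of_le (by simp)), ?_, fun v => ?_⟩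
  · rw [dmap, hd]
    exact h2.comp (hφinv x hx).surjective
  · rw [dmap, hd, ← hmem x hx h4]
    exact h3 _

end FlowBox

/-! ### Passing between manifolds and charts. -/

section Charts

variable {E : Type*} [NormedAddCommGroup E] [NormedSpace ℝ E]
  {M : Type*} [TopologicalSpace M] [ChartedSpace E M]
  {F : Type*} [NormedAddCommGroup F] [NormedSpace ℝ F]

/-- The tangent map, as a map between the model spaces. -/
abbrev flatDmap (E F : Type*) [NormedAddCommGroup E] [NormedSpace ℝ E] [NormedAddCommGroup F]
    [NormedSpace ℝ F] {M : Type*} [TopologicalSpace M] [ChartedSpace E M] {N : Type*}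
    [TopologicalSpace N] [ChartedSpace F N] (f : M → N) (x : M) : E →L[ℝ] F :=
  dmap E F f x

/-- The tangent space at `x` is identified with `E` by the preferred chart at `x` itself, so no
derivative of the chart appears here. At other points of the chart it does, see
`hasFDerivAt_chart_symm`. -/
theorem hasFDerivAt_chart {f : M → F} {x : M} (hf : MDifferentiableAt 𝓘(ℝ, E) 𝓘(ℝ, F) f x) :
    HasFDerivAt (f ∘ (extChartAt 𝓘(ℝ, E) x).symm) (flatDmap E F f x)
      (extChartAt 𝓘(ℝ, E) x x) := by
  have h : HasFDerivWithinAt (f ∘ (extChartAt 𝓘(ℝ, E) x).symm) (flatDmap E F f x) univ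
      (extChartAt 𝓘(ℝ, E) x x) := by
    have := hf.hasMFDerivAt.2
    rw [ModelWithCorners.range_eq_univ] at this
    exact this
  exact hasFDerivWithinAt_univ.1 h

theorem contDiffAt_chart {f : M → F} {x : M} {n : WithTop ℕ∞}
    (hf : ContMDiffAt 𝓘(ℝ, E) 𝓘(ℝ, F) n f x) :
    ContDiffAt ℝ n (f ∘ (extChartAt 𝓘(ℝ, E) x).symm) (extChartAt 𝓘(ℝ, E) x x) := by
  have := (contMDiffAt_iff.1 hf).2
  rw [ModelWithCorners.range_eq_univ, contDiffWithinAt_univ] at this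
  exact this

theorem eventually_chart {x : M} {p : M → Prop} :
    (∀ᶠ y in 𝓝 (extChartAt 𝓘(ℝ, E) x x), p ((extChartAt 𝓘(ℝ, E) x).symm y)) ↔
      ∀ᶠ z in 𝓝 x, p z := by
  constructor
  · intro h
    filter_upwards [(continuousAt_extChartAt (I := 𝓘(ℝ, E)) x).eventually h,
      extChartAt_source_mem_nhds (I := 𝓘(ℝ, E)) x] with z hz hz'
    rwa [(extChartAt 𝓘(ℝ, E) x).left_inv hz'] at hz
  · intro h
    have hc := continuousAt_extChartAt_symm (I := 𝓘(ℝ, E)) x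
    have := hc.tendsto
    rw [extChartAt_to_inv] at this
    exact this.eventually h

variable [IsManifold 𝓘(ℝ, E) 1 M]

theorem eventually_mdifferentiableAt {f : M → F} {x : M}
    (hf : ContMDiffAt 𝓘(ℝ, E) 𝓘(ℝ, F) 1 f x) :
    ∀ᶠ y in 𝓝 x, MDifferentiableAt 𝓘(ℝ, E) 𝓘(ℝ, F) f y :=
  ((contMDiffAt_iff_contMDiffAt_nhds (by simp)).1 hf).mono
    fun _ h => h.mdifferentiableAt one_ne_zero

theorem hasFDerivAt_chart_symm {f : M → F} {x : M} {y : E}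
    (hy : y ∈ (extChartAt 𝓘(ℝ, E) x).target)
    (hf : MDifferentiableAt 𝓘(ℝ, E) 𝓘(ℝ, F) f ((extChartAt 𝓘(ℝ, E) x).symm y)) :
    HasFDerivAt (f ∘ (extChartAt 𝓘(ℝ, E) x).symm)
      ((flatDmap E F f ((extChartAt 𝓘(ℝ, E) x).symm y)).comp
        (flatDmap E E (extChartAt 𝓘(ℝ, E) x).symm y)) y := by
  have h1 : MDifferentiableAt 𝓘(ℝ, E) 𝓘(ℝ, E) (extChartAt 𝓘(ℝ, E) x).symm y :=
    ((contMDiffOn_extChartAt_symm (n := 1) x).contMDiffAt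
      ((isOpen_extChartAt_target x).mem_nhds hy)).mdifferentiableAt one_ne_zero
  exact (hf.hasMFDerivAt.comp y h1.hasMFDerivAt).hasFDerivAt

theorem eventually_eq_of_dmap_eq_zero {g : M → F} {x : M}
    (hg : ∀ᶠ y in 𝓝 x, MDifferentiableAt 𝓘(ℝ, E) 𝓘(ℝ, F) g y ∧ dmap E F g y = 0) :
    ∀ᶠ y in 𝓝 x, g y = g x := by
  have h0 : g x = (g ∘ (extChartAt 𝓘(ℝ, E) x).symm) (extChartAt 𝓘(ℝ, E) x x) := by simp
  rw [← eventually_chart (E := E), h0]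
  refine eventually_eq_of_hasFDerivAt_zero ?_
  filter_upwards [eventually_chart.2 hg, extChartAt_target_mem_nhds (I := 𝓘(ℝ, E)) x]
    with y hy hy'
  have := hasFDerivAt_chart_symm hy' hy.1
  rw [show flatDmap E F g ((extChartAt 𝓘(ℝ, E) x).symm y) = 0 from hy.2,
    ContinuousLinearMap.zero_comp] at this
  exact this

variable [CompleteSpace E] [FiniteDimensional ℝ F]
  {G : Type*} [NormedAddCommGroup G] [NormedSpace ℝ G]

/-- The chart version of `eventually_eq_of_ker_le`; inclusion of kernels survives composition with
the derivative of the chart. It serves to compare the transverse coordinates of two overlapping flow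
boxes. -/
theorem eventually_eq_of_dmap_ker_le {f : M → F} {x : M}
    (hf : ContMDiffAt 𝓘(ℝ, E) 𝓘(ℝ, F) 1 f x) (hsurj : Function.Surjective (dmap E F f x))
    {g : M → G} (hg : ContMDiffAt 𝓘(ℝ, E) 𝓘(ℝ, G) 1 g x)
    (hker : ∀ᶠ y in 𝓝 x, ∀ v, dmap E F f y v = 0 → dmap E G g y v = 0) :
    ∀ᶠ y in 𝓝 x, f y = f x → g y = g x := by
  have hfd := hasFDerivAt_chart (hf.mdifferentiableAt one_ne_zero)
  have key := eventually_eq_of_ker_le (contDiffAt_chart hf) (by rw [hfd.fderiv]; exact hsurj)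
    (g := g ∘ (extChartAt 𝓘(ℝ, E) x).symm)
    (((contDiffAt_chart hg).eventually (by simp)).mono
      fun _ h => h.differentiableAt one_ne_zero) (by
      filter_upwards [eventually_chart.2 (eventually_mdifferentiableAt hf), eventually_chart.2 (eventually_mdifferentiableAt hg),
        eventually_chart.2 hker, extChartAt_target_mem_nhds (I := 𝓘(ℝ, E)) x]
        with y h1 h2 h3 h4 v hv
      rw [(hasFDerivAt_chart_symm h4 h1).fderiv] at hv
      rw [(hasFDerivAt_chart_symm h4 h2).fderiv]
      exact h3 _ hv)
  rw [← eventually_chart (E := E)]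
  simpa using key

end Charts

/-! ### Leaves -/

section Leaves

variable {E : Type*} [NormedAddCommGroup E] [NormedSpace ℝ E]
  {M : Type*} [TopologicalSpace M] [ChartedSpace E M]
  {F : Type*} [NormedAddCommGroup F] [NormedSpace ℝ F]

/-- `t` is a submersion on the open set `U` whose level sets are tangent to `Δ`. -/
structure IsFlowBox (Δ : ∀ x : M, Submodule ℝ (TangentSpace 𝓘(ℝ, E) x)) (U : Set M) (t : M → F) :
    Prop where
  isOpen : IsOpen U
  contMDiffAt : ∀ x ∈ U, ContMDiffAt 𝓘(ℝ, E) 𝓘(ℝ, F) 1 t x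
  surjective : ∀ x ∈ U, Function.Surjective (dmap E F t x)
  ker : ∀ x ∈ U, ∀ v, dmap E F t x v = 0 ↔ v ∈ Δ x

variable {Δ : ∀ x : M, Submodule ℝ (TangentSpace 𝓘(ℝ, E) x)}

theorem IsFlowBox.mdifferentiableAt {U : Set M} {t : M → F} (h : IsFlowBox Δ U t) {x : M}
    (hx : x ∈ U) : MDifferentiableAt 𝓘(ℝ, E) 𝓘(ℝ, F) t x :=
  (h.contMDiffAt x hx).mdifferentiableAt one_ne_zero

/-- `x` and `y` are in the same level set of one of the flow boxes `(U i, t i)`. -/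
def SamePlaque {ι : Type*} (U : ι → Set M) (t : ι → M → F) (x y : M) : Prop :=
  ∃ i, x ∈ U i ∧ y ∈ U i ∧ t i x = t i y

/-- `x` and `y` are joined by a chain of level sets of the flow boxes `(U i, t i)`. -/
def SameLeaf {ι : Type*} (U : ι → Set M) (t : ι → M → F) : M → M → Prop :=
  Relation.ReflTransGen (SamePlaque U t)

theorem SameLeaf.symm {ι : Type*} {U : ι → Set M} {t : ι → M → F} {x y : M}
    (h : SameLeaf U t x y) : SameLeaf U t y x := by
  induction h with
  | refl => exact .refl
  | tail _ h ih =>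
    obtain ⟨i, h1, h2, h3⟩ := h
    exact ih.head ⟨i, h2, h1, h3.symm⟩

/-- A curve tangent to `Δ` stays in a leaf. -/
theorem IsJoinedBySmooth.sameLeaf {ι : Type*} {U : ι → Set M} {t : ι → M → F}
    (hUt : ∀ i, IsFlowBox Δ (U i) (t i)) (hcover : ∀ x, ∃ i, x ∈ U i) {x y : M}
    (h : IsJoinedBySmooth Δ x y) : SameLeaf U t x y := by
  obtain ⟨a, b, c, hab, hc, hcΔ, rfl, rfl⟩ := h
  -- Connectedness of the interval leaves a local claim: near `s` the curve remains in one flow box,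
  -- where the transverse coordinate has zero derivative along it.
  refine isPreconnected_Icc.induction₂ (fun s s' => SameLeaf U t (c s) (c s')) ?_
    (fun _ _ _ _ _ _ h h' => Relation.ReflTransGen.trans h h') (fun _ _ _ _ h => h.symm)
    (left_mem_Icc.2 hab.le) (right_mem_Icc.2 hab.le)
  intro s hs
  obtain ⟨i, hi⟩ := hcover (c s)
  have hnhds := (hc s hs).continuousWithinAt.preimage_mem_nhdsWithin ((hUt i).isOpen.mem_nhds hi)
  obtain ⟨ε, hε, H⟩ := Metric.mem_nhdsWithin_iff.1 hnhds
  filter_upwards [inter_mem_nhdsWithin (Icc a b) (Metric.ball_mem_nhds s hε)] with s' hs'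
  refine Relation.ReflTransGen.single ⟨i, hi, H hs'.symm, ?_⟩
  have hd : ∀ τ ∈ Icc a b ∩ Metric.ball s ε,
      HasFDerivWithinAt (𝕜 := ℝ) (fun τ => t i (c τ)) 0 (Icc a b ∩ Metric.ball s ε) τ := by
    intro τ hτ
    have h1 := (hUt i).mdifferentiableAt (H hτ.symm)
    have h2 := (hc τ hτ.1).mdifferentiableWithinAt (by simp)
    let L : ℝ →L[ℝ] E := mfderivWithin 𝓘(ℝ, ℝ) 𝓘(ℝ, E) c (Icc a b) τ
    have h3 : HasFDerivWithinAt (fun τ => t i (c τ)) ((flatDmap E F (t i) (c τ)).comp L)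
        (Icc a b) τ :=
      (h1.hasMFDerivAt.comp_hasMFDerivWithinAt τ h2.hasMFDerivWithinAt).hasFDerivWithinAt
    have h4 : (flatDmap E F (t i) (c τ)).comp L = 0 :=
      ContinuousLinearMap.ext_ring (((hUt i).ker _ (H hτ.symm) _).2 (hcΔ τ hτ.1))
    rw [h4] at h3
    exact h3.mono inter_subset_left
  have hconv : Convex ℝ (Icc a b ∩ Metric.ball s ε) := (convex_Icc a b).inter (convex_ball s ε)
  have := hconv.norm_image_sub_le_of_norm_hasFDerivWithin_le (C := 0) hd (by simp)
    ⟨hs, Metric.mem_ball_self hε⟩ hs'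
  rw [zero_mul, norm_le_zero_iff, sub_eq_zero] at this
  exact this.symm

theorem IsReachable.sameLeaf {ι : Type*} {U : ι → Set M} {t : ι → M → F}
    (hUt : ∀ i, IsFlowBox Δ (U i) (t i)) (hcover : ∀ x, ∃ i, x ∈ U i) {x y : M}
    (h : IsReachable Δ x y) : SameLeaf U t x y := by
  induction h with
  | refl => exact .refl
  | tail _ h ih => exact Relation.ReflTransGen.trans ih (h.sameLeaf hUt hcover)

variable [IsManifold 𝓘(ℝ, E) 1 M] [CompleteSpace E] [FiniteDimensional ℝ F]
  [SecondCountableTopology M]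

/-- A level set of one flow box meets countably many level sets of another one. -/
theorem IsFlowBox.countable_image_levelSet {U U' : Set M} {t t' : M → F} (h : IsFlowBox Δ U t)
    (h' : IsFlowBox Δ U' t') (c : F) : (t' '' (U ∩ U' ∩ t ⁻¹' {c})).Countable := by
  have hloc : ∀ x ∈ U ∩ U' ∩ t ⁻¹' {c},
      {y | t y = t x → t' y = t' x} ∈ 𝓝[U ∩ U' ∩ t ⁻¹' {c}] x := by
    rintro x ⟨⟨hx, hx'⟩, -⟩
    refine mem_nhdsWithin_of_mem_nhds ?_
    refine eventually_eq_of_dmap_ker_le (h.contMDiffAt x hx) (h.surjective x hx)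
      (h'.contMDiffAt x hx') ?_
    filter_upwards [h.isOpen.mem_nhds hx, h'.isOpen.mem_nhds hx'] with y hy hy' v hv
    exact (h'.ker y hy' v).2 ((h.ker y hy v).1 hv)
  -- By the Lindelöf property, `t'` being locally constant on the level set of `t` leaves only
  -- countably many values.
  obtain ⟨T, hTs, hT, hcov⟩ := TopologicalSpace.countable_cover_nhdsWithin hloc
  refine (hT.image t').mono ?_
  rintro _ ⟨y, hy, rfl⟩
  obtain ⟨x, hx, hxy⟩ := mem_iUnion₂.1 (hcov hy)
  refine ⟨x, hx, (hxy ?_).symm⟩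
  rw [hy.2, (hTs hx).2]

/-- A leaf meets each flow box in countably many level sets. -/
theorem countable_image_leaf {ι : Type*} [Countable ι] {U : ι → Set M} {t : ι → M → F}
    (hUt : ∀ i, IsFlowBox Δ (U i) (t i)) (x : M) (j : ι) :
    (t j '' {y | y ∈ U j ∧ SameLeaf U t x y}).Countable := by
  -- The leaf of `x` is the union of the iterates of `next` on `{x}`. Each step preserves the
  -- property of meeting every box in countably many plaques.
  let next : Set M → Set M := fun L => {y | ∃ z ∈ L, SamePlaque U t z y}
  have hnext : ∀ L : Set M, (∀ j, (t j '' (L ∩ U j)).Countable) →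
      ∀ j, (t j '' (next L ∩ U j)).Countable := by
    intro L hL j
    have hcount : (⋃ i, ⋃ c ∈ t i '' (L ∩ U i), t j '' (U i ∩ U j ∩ t i ⁻¹' {c})).Countable :=
      countable_iUnion fun i => (hL i).biUnion fun c _ =>
        (hUt i).countable_image_levelSet (hUt j) c
    refine hcount.mono ?_
    rintro _ ⟨y, ⟨⟨z, hz, i, hzi, hyi, hzy⟩, hyj⟩, rfl⟩
    exact mem_iUnion.2 ⟨i, mem_iUnion₂.2 ⟨t i z, ⟨z, ⟨hz, hzi⟩, rfl⟩, y, ⟨⟨hyi, hyj⟩, hzy.symm⟩, rfl⟩⟩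
  have hiter : ∀ n : ℕ, ∀ j, (t j '' ((next^[n] {x}) ∩ U j)).Countable := by
    intro n
    induction n with
    | zero =>
      intro j
      exact (((countable_singleton x).mono inter_subset_left).image _)
    | succ n ih =>
      rw [Function.iterate_succ_apply']
      exact hnext _ ih
  refine (countable_iUnion fun n => hiter n j).mono ?_
  rintro _ ⟨y, ⟨hyj, hxy⟩, rfl⟩
  have : ∃ n, y ∈ next^[n] {x} := by
    clear hyj
    induction hxy with
    | refl => exact ⟨0, rfl⟩
    | tail _ h ih =>
      obtain ⟨n, hn⟩ := ih
      refine ⟨n + 1, ?_⟩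
      rw [Function.iterate_succ_apply']
      exact ⟨_, hn, h⟩
  obtain ⟨n, hn⟩ := this
  exact mem_iUnion.2 ⟨n, y, ⟨hn, hyj⟩, rfl⟩

end Leaves

/-- An involutive distribution on a second countable manifold has a countable cover by flow
boxes. -/
theorem exists_countable_flowBoxes {E : Type*} [NormedAddCommGroup E] [NormedSpace ℝ E]
    [FiniteDimensional ℝ E] {M : Type*} [TopologicalSpace M] [ChartedSpace E M]
    [IsManifold 𝓘(ℝ, E) ∞ M] [SecondCountableTopology M]
    {Δ : ∀ x : M, Submodule ℝ (TangentSpace 𝓘(ℝ, E) x)} {r : ℕ}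
    (hΔ : IsDistribution Δ r) (hinv : IsInvolutive Δ) :
    ∃ (c : Set M) (U : c → Set M) (t : c → M → (Fin (finrank ℝ E - r) → ℝ)), c.Countable ∧
      (∀ i, IsFlowBox Δ (U i) (t i)) ∧ ∀ x, ∃ i, x ∈ U i := by
  choose U hU hxU t ht using exists_flowBox hΔ hinv
  obtain ⟨c, hc, hcov⟩ := TopologicalSpace.countable_cover_nhds
    (fun x => (hU x).mem_nhds (hxU x))
  refine ⟨c, fun i => U i, fun i => t i, hc, fun i => ⟨hU i, fun x hx => (ht i x hx).1,
    fun x hx => (ht i x hx).2.1, fun x hx => (ht i x hx).2.2⟩, fun x => ?_⟩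
  obtain ⟨i, hi, hxi⟩ := mem_iUnion₂.1 (hcov.symm ▸ mem_univ x)
  exact ⟨⟨i, hi⟩, hxi⟩

/-! ### Dimension counts for the tangent spaces of the velocity constraint. -/

section LinearAlgebra

variable {A V Q : Type*} [AddCommGroup A] [Module ℝ A] [FiniteDimensional ℝ A]
  [AddCommGroup V] [Module ℝ V] [FiniteDimensional ℝ V]
  [AddCommGroup Q] [Module ℝ Q] [FiniteDimensional ℝ Q]

/-- The pair of two maps with complementary kernels is onto. -/
theorem exists_apply_eq_pair (hdim : finrank ℝ V = 2 * finrank ℝ Q) {m p : V →ₗ[ℝ] Q}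
    (hmp : ∀ v, m v = 0 → p v = 0 → v = 0) (x y : Q) : ∃ v, m v = x ∧ p v = y := by
  have hinj : Function.Injective (m.prod p) := by
    rw [injective_iff_map_eq_zero]
    intro v hv
    exact hmp v (congrArg Prod.fst hv) (congrArg Prod.snd hv)
  have hsurj := (LinearMap.injective_iff_surjective_of_finrank_eq_finrank
    (by rw [hdim, finrank_prod, two_mul])).1 hinj
  obtain ⟨v, hv⟩ := hsurj (x, y)
  exact ⟨v, congrArg Prod.fst hv, congrArg Prod.snd hv⟩

/-- If the tangent space of the constraint submanifold respects the distribution, then it contains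
all vectors with both components in the distribution. -/
theorem exists_preimage_of_mem_distribution {a : A →ₗ[ℝ] V} {m p : V →ₗ[ℝ] Q} {X Y : Submodule ℝ Q}
    {r : ℕ} (ha : Function.Injective a) (hmp : ∀ v, m v = 0 → p v = 0 → v = 0)
    (hma : Function.Surjective fun u => m (a u)) (hA : finrank ℝ A = finrank ℝ Q + r)
    (hX : finrank ℝ X = r) (hY : finrank ℝ Y = r) (hXY : ∀ u, m (a u) ∈ X → p (a u) ∈ Y)
    {v : V} (hv : m v ∈ X) (hv' : p v ∈ Y) : ∃ u, a u = v := by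
  -- Its kernel has dimension `(dim Q + r) - (dim Q - r) = 2r`, which is that of `X × Y`. The
  -- injection `L` below is therefore onto.
  let φ : A →ₗ[ℝ] Q ⧸ X := X.mkQ ∘ₗ m ∘ₗ a
  have hφ : Function.Surjective φ := X.mkQ_surjective.comp hma
  have hφk : ∀ u, u ∈ LinearMap.ker φ ↔ m (a u) ∈ X := fun u => by
    simp [φ, LinearMap.mem_ker]
  have h1 := LinearMap.finrank_range_add_finrank_ker φ
  rw [LinearMap.range_eq_top.2 hφ, finrank_top, Submodule.finrank_quotient, hA, hX] at h1
  have h2 : r ≤ finrank ℝ Q := hX ▸ X.finrank_le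
  let L : LinearMap.ker φ →ₗ[ℝ] X × Y :=
    ((m ∘ₗ a ∘ₗ (LinearMap.ker φ).subtype).codRestrict X fun u => (hφk u).1 u.2).prod
      ((p ∘ₗ a ∘ₗ (LinearMap.ker φ).subtype).codRestrict Y fun u => hXY u ((hφk u).1 u.2))
  have hL : Function.Injective L := by
    rw [injective_iff_map_eq_zero]
    intro u hu
    have e1 : m (a u) = 0 := congrArg (fun z => (z.1 : Q)) hu
    have e2 : p (a u) = 0 := congrArg (fun z => (z.2 : Q)) hu
    have e3 := hmp _ e1 e2
    rw [← map_zero a] at e3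
    exact Subtype.ext (ha e3)
  have hLs := (LinearMap.injective_iff_surjective_of_finrank_eq_finrank
    (by rw [finrank_prod, hX, hY]; omega)).1 hL
  obtain ⟨u, hu⟩ := hLs (⟨m v, hv⟩, ⟨p v, hv'⟩)
  have e1 : m (a u) = m v := congrArg (fun z => (z.1 : Q)) hu
  have e2 : p (a u) = p v := congrArg (fun z => (z.2 : Q)) hu
  exact ⟨u, sub_eq_zero.1 (hmp _ (by rw [map_sub, e1, sub_self]) (by rw [map_sub, e2, sub_self]))⟩

end LinearAlgebra

/-- The base point `y` is a separate variable, so that points that are only propositionally equal,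
such as `1 • x` and `x`, cause no casts between tangent spaces. -/
theorem flatDmap_comp {E₁ E₂ E₃ : Type*} [NormedAddCommGroup E₁] [NormedSpace ℝ E₁]
    [NormedAddCommGroup E₂] [NormedSpace ℝ E₂] [NormedAddCommGroup E₃] [NormedSpace ℝ E₃]
    {M₁ M₂ M₃ : Type*} [TopologicalSpace M₁] [ChartedSpace E₁ M₁]
    [TopologicalSpace M₂] [ChartedSpace E₂ M₂] [TopologicalSpace M₃] [ChartedSpace E₃ M₃]
    {g : M₂ → M₃} {f : M₁ → M₂} {x : M₁} {y : M₂}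
    (hg : MDifferentiableAt 𝓘(ℝ, E₂) 𝓘(ℝ, E₃) g y) (hf : MDifferentiableAt 𝓘(ℝ, E₁) 𝓘(ℝ, E₂) f x)
    (hy : f x = y) :
    flatDmap E₁ E₃ (fun x => g (f x)) x = (flatDmap E₂ E₃ g y).comp (flatDmap E₁ E₂ f x) := by
  subst hy
  exact mfderiv_comp x hg hf

/-! ### Orbits and infinitesimal generators. -/

section Action

variable {EG : Type*} [NormedAddCommGroup EG] [NormedSpace ℝ EG]
  {G : Type*} [TopologicalSpace G] [ChartedSpace EG G] [Group G] [LieGroup 𝓘(ℝ, EG) ∞ G]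
  {E : Type*} [NormedAddCommGroup E] [NormedSpace ℝ E]
  {M : Type*} [TopologicalSpace M] [ChartedSpace E M] [MulAction G M]
  [ContMDiffSMul 𝓘(ℝ, EG) 𝓘(ℝ, E) ∞ G M]

variable (EG G E) in
theorem contMDiff_orbit (x : M) : ContMDiff 𝓘(ℝ, EG) 𝓘(ℝ, E) ∞ fun g : G => g • x :=
  contMDiff_id.smul contMDiff_const

variable (EG E) in
theorem mdifferentiableAt_orbit (x : M) (g : G) :
    MDifferentiableAt 𝓘(ℝ, EG) 𝓘(ℝ, E) (fun g : G => g • x) g :=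
  (contMDiff_orbit EG G E x).mdifferentiable (by simp) g

/-- The velocity of an orbit is an infinitesimal generator. -/
theorem flatDmap_orbit (x : M) (g : G) (w : EG) :
    ∃ ξ : EG, flatDmap EG E (fun g : G => g • x) g w =
      flatDmap EG E (fun g' : G => g' • (g • x)) 1 ξ := by
  -- Writing `g' • x = (g' g⁻¹) • (g • x)`, right translation carries the velocity at `g` to the
  -- identity.
  have h1 : ContMDiff 𝓘(ℝ, EG) 𝓘(ℝ, EG) ∞ fun g' : G => g' * g⁻¹ := contMDiff_mul_right
  have h2 := (h1.mdifferentiable (by simp) g)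
  have h3 := flatDmap_comp (mdifferentiableAt_orbit EG E (g • x) 1) h2 (mul_inv_cancel g)
  simp only [smul_smul, inv_mul_cancel_right] at h3
  rw [h3]
  exact ⟨_, by simp only [smul_smul]; rfl⟩

/-- Equivariant maps respect infinitesimal generators. -/
theorem dmap_infGen {E' : Type*} [NormedAddCommGroup E'] [NormedSpace ℝ E']
    {N : Type*} [TopologicalSpace N] [ChartedSpace E' N] [MulAction G N]
    {f : M → N} (hf : ∀ (g : G) (x : M), f (g • x) = g • f x) {x : M}
    (hd : MDifferentiableAt 𝓘(ℝ, E) 𝓘(ℝ, E') f x) (ξ : GroupLieAlgebra 𝓘(ℝ, EG) G) :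
    dmap E E' f x (infGen G x ξ) = infGen G (f x) ξ := by
  have h3 := flatDmap_comp hd (mdifferentiableAt_orbit EG E x (1 : G)) (one_smul G x)
  simp only [hf] at h3
  exact (congrArg (fun L : EG →L[ℝ] E' => L ξ) h3).symm

/-- If the infinitesimal generators are tangent to `Δ`, the orbits locally stay in the level
sets of the flow boxes. -/
theorem IsFlowBox.eventually_smul_eq {F : Type*} [NormedAddCommGroup F] [NormedSpace ℝ F]
    {Δ : ∀ x : M, Submodule ℝ (TangentSpace 𝓘(ℝ, E) x)} {U : Set M} {t : M → F}
    (h : IsFlowBox Δ U t)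
    (hgen : ∀ (ξ : GroupLieAlgebra 𝓘(ℝ, EG) G) (x : M), infGen G x ξ ∈ Δ x) {x : M} (hx : x ∈ U) :
    ∀ᶠ g : G in 𝓝 1, t (g • x) = t x := by
  have : IsManifold 𝓘(ℝ, EG) 1 G := IsManifold.of_le (n := ∞) (by simp)
  have hU : ∀ᶠ g : G in 𝓝 1, g • x ∈ U :=
    (contMDiff_orbit EG G E x).continuous.continuousAt.preimage_mem_nhds
      (h.isOpen.mem_nhds (by rwa [one_smul]))
  -- The derivative has to vanish at all `g` near `1`, not only at `1`; there the velocity of the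
  -- orbit is a generator at `g • x`, which lies in `Δ = ker dt`.
  have := eventually_eq_of_dmap_eq_zero (E := EG) (g := fun g : G => t (g • x)) (x := 1) (by
    filter_upwards [hU] with g hg
    have h1 := h.mdifferentiableAt hg
    have h2 := mdifferentiableAt_orbit EG E x g
    refine ⟨h1.comp g h2, ?_⟩
    have h3 := mfderiv_comp g h1 h2
    refine ContinuousLinearMap.ext fun w => ?_
    refine (congrArg (fun L : EG →L[ℝ] F => L w) h3).trans ?_
    refine (h.ker _ hg _).2 ?_
    obtain ⟨ξ, hξ⟩ := flatDmap_orbit (EG := EG) (E := E) x g w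
    exact hξ ▸ hgen ξ (g • x))
  simpa using this

end Action

/-! ### Local structure of the velocity constraint. -/

section Systems

variable {EQ : Type*} [NormedAddCommGroup EQ] [NormedSpace ℝ EQ] [FiniteDimensional ℝ EQ]
  {Q : Type*} [TopologicalSpace Q] [ChartedSpace EQ Q] [IsManifold 𝓘(ℝ, EQ) ∞ Q]
  {EV : Type*} [NormedAddCommGroup EV] [NormedSpace ℝ EV] [FiniteDimensional ℝ EV]
  {V : Type*} [TopologicalSpace V] [ChartedSpace EV V]
  {ED : Type*} [NormedAddCommGroup ED] [NormedSpace ℝ ED] [FiniteDimensional ℝ ED]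
  {D : Type*} [TopologicalSpace D] [ChartedSpace ED D]
  {F : Type*} [NormedAddCommGroup F] [NormedSpace ℝ F] [FiniteDimensional ℝ F]

namespace DCLS

variable (S : DCLS EQ Q EV V ED D)

theorem mdifferentiable_plus : MDifferentiable 𝓘(ℝ, EV) 𝓘(ℝ, EQ) S.plus :=
  S.plus_submersive.smooth.mdifferentiable (by simp)

theorem mdifferentiable_minus : MDifferentiable 𝓘(ℝ, EV) 𝓘(ℝ, EQ) S.minus :=
  S.minus_submersive.smooth.mdifferentiable (by simp)

theorem mdifferentiable_incl : MDifferentiable 𝓘(ℝ, ED) 𝓘(ℝ, EV) S.incl :=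
  S.incl_emb.smooth.mdifferentiable (by simp)

theorem eq_zero_of_flatDmap_eq_zero (v : V) (w : EV) (hm : flatDmap EV EQ S.minus v w = 0)
    (hp : flatDmap EV EQ S.plus v w = 0) : w = 0 := by
  have : w ∈ (dmap EV EQ S.plus v).ker ⊓ (dmap EV EQ S.minus v).ker := ⟨hp, hm⟩
  rw [S.ker_inf_ker v] at this
  exact this

theorem flatDmap_minus_incl (d : D) : flatDmap ED EQ (S.minus ∘ S.incl) d =
    (flatDmap EV EQ S.minus (S.incl d)).comp (flatDmap ED EV S.incl d) :=
  flatDmap_comp (S.mdifferentiable_minus _) (S.mdifferentiable_incl d) rfl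

theorem flatDmap_plus_incl (d : D) : flatDmap ED EQ (S.plus ∘ S.incl) d =
    (flatDmap EV EQ S.plus (S.incl d)).comp (flatDmap ED EV S.incl d) :=
  flatDmap_comp (S.mdifferentiable_plus _) (S.mdifferentiable_incl d) rfl

theorem surjective_flatDmap_minus_incl (d : D) : Function.Surjective fun u =>
    flatDmap EV EQ S.minus (S.incl d) (flatDmap ED EV S.incl d u) := by
  have := S.minus_incl_submersive.surjective d
  rw [show dmap ED EQ (S.minus ∘ S.incl) d = _ from S.flatDmap_minus_incl d] at this
  exact this

variable {S} {Δ : ∀ q : Q, Submodule ℝ (TangentSpace 𝓘(ℝ, EQ) q)}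
  {ι : Type*} {U : ι → Set Q} {t : ι → Q → F}

/-- The transverse coordinates of `∂⁻` form a submersion on the velocity constraint. -/
theorem minus_transverse (hUt : ∀ i, IsFlowBox Δ (U i) (t i)) {i : ι} {d : D}
    (hi : S.minus (S.incl d) ∈ U i) :
    ContMDiffAt 𝓘(ℝ, ED) 𝓘(ℝ, F) 1 (fun d => t i (S.minus (S.incl d))) d ∧
    (∀ u, flatDmap ED F (fun d => t i (S.minus (S.incl d))) d u = 0 ↔
      flatDmap EV EQ S.minus (S.incl d) (flatDmap ED EV S.incl d u) ∈
        (Δ (S.minus (S.incl d)) : Submodule ℝ EQ)) ∧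
    Function.Surjective (flatDmap ED F (fun d => t i (S.minus (S.incl d))) d) := by
  have hd : flatDmap ED F (fun d => t i (S.minus (S.incl d))) d =
      (flatDmap EQ F (t i) (S.minus (S.incl d))).comp (flatDmap ED EQ (S.minus ∘ S.incl) d) :=
    flatDmap_comp ((hUt i).mdifferentiableAt hi)
      ((S.minus_incl_submersive.smooth.mdifferentiable (by simp)) d) rfl
  refine ⟨?_, fun u => ?_, ?_⟩
  · exact ((hUt i).contMDiffAt _ hi).comp d
      ((S.minus_incl_submersive.smooth.of_le (by simp)).contMDiffAt)
  · rw [hd, S.flatDmap_minus_incl]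
    exact (hUt i).ker _ hi _
  · rw [hd]
    exact ((hUt i).surjective _ hi).comp (S.minus_incl_submersive.surjective d)

/-- The counterpart of `minus_transverse` for `∂⁺`. Surjectivity is left out because this coordinate
enters as the function shown to be locally constant on the level sets of the other one. -/
theorem plus_transverse (hUt : ∀ i, IsFlowBox Δ (U i) (t i)) {j : ι} {d : D}
    (hj : S.plus (S.incl d) ∈ U j) :
    ContMDiffAt 𝓘(ℝ, ED) 𝓘(ℝ, F) 1 (fun d => t j (S.plus (S.incl d))) d ∧
    ∀ u, flatDmap ED F (fun d => t j (S.plus (S.incl d))) d u = 0 ↔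
      flatDmap EV EQ S.plus (S.incl d) (flatDmap ED EV S.incl d u) ∈
        (Δ (S.plus (S.incl d)) : Submodule ℝ EQ) := by
  have hd : flatDmap ED F (fun d => t j (S.plus (S.incl d))) d =
      (flatDmap EQ F (t j) (S.plus (S.incl d))).comp (flatDmap ED EQ (S.plus ∘ S.incl) d) :=
    flatDmap_comp ((hUt j).mdifferentiableAt hj)
      ((S.plus_incl_submersive.smooth.mdifferentiable (by simp)) d) rfl
  refine ⟨?_, fun u => ?_⟩
  · exact ((hUt j).contMDiffAt _ hj).comp d
      ((S.plus_incl_submersive.smooth.of_le (by simp)).contMDiffAt)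
  · rw [hd, S.flatDmap_plus_incl]
    exact (hUt j).ker _ hj _

/-- On the velocity constraint, the leaf of `∂⁻` determines the one of `∂⁺` locally. -/
theorem eventually_plus_eq [SecondCountableTopology Q] [Countable ι]
    (hUt : ∀ i, IsFlowBox Δ (U i) (t i)) (hcover : ∀ q, ∃ i, q ∈ U i)
    (hreach : ∀ d, IsReachable Δ (S.minus (S.incl d)) (S.plus (S.incl d))) {i j : ι} {d : D}
    (hi : S.minus (S.incl d) ∈ U i) (hj : S.plus (S.incl d) ∈ U j) :
    ∀ᶠ d' in 𝓝 d, t i (S.minus (S.incl d')) = t i (S.minus (S.incl d)) →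
      t j (S.plus (S.incl d')) = t j (S.plus (S.incl d)) := by
  have : CompleteSpace ED := FiniteDimensional.complete ℝ ED
  have : CompleteSpace EQ := FiniteDimensional.complete ℝ EQ
  have : IsManifold 𝓘(ℝ, EQ) 1 Q := IsManifold.of_le (n := ∞) (by simp)
  obtain ⟨hf, -, hfs⟩ := minus_transverse hUt hi
  obtain ⟨hg, -⟩ := plus_transverse hUt hj
  have hmem : ∀ᶠ d' in 𝓝 d, S.minus (S.incl d') ∈ U i ∧ S.plus (S.incl d') ∈ U j :=
    Filter.Eventually.and
    (S.minus_incl_submersive.smooth.continuous.continuousAt.preimage_mem_nhds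
      ((hUt i).isOpen.mem_nhds hi))
    (S.plus_incl_submersive.smooth.continuous.continuousAt.preimage_mem_nhds
      ((hUt j).isOpen.mem_nhds hj))
  -- If `∂⁻ d'` is in the plaque of `∂⁻ d`, reachability puts `∂⁺ d'` in the leaf of `∂⁻ d`, which
  -- has only countably many plaques in `U j`.
  have key := eventually_eq_of_countable (contDiffAt_chart hf)
    (hasFDerivAt_chart (hf.mdifferentiableAt one_ne_zero)) hfs
    (((contDiffAt_chart hg).eventually (by simp)).mono fun _ h => h.continuousAt)
    (countable_image_leaf hUt (S.minus (S.incl d)) j) (by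
      filter_upwards [eventually_chart.2 hmem] with y hy hfy
      refine ⟨_, ⟨hy.2, ?_⟩, rfl⟩
      refine Relation.ReflTransGen.trans (.single ⟨i, hi, hy.1, ?_⟩)
        ((hreach _).sameLeaf hUt hcover)
      simpa using hfy.symm)
  rw [← eventually_chart (E := ED)]
  simpa using key

/-- A tangent vector of `V` both of whose components are in the distribution is tangent to the
velocity constraint. -/
theorem exists_flatDmap_incl_eq [SecondCountableTopology Q] [Countable ι]
    (hUt : ∀ i, IsFlowBox Δ (U i) (t i)) (hcover : ∀ q, ∃ i, q ∈ U i)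
    (hreach : ∀ d, IsReachable Δ (S.minus (S.incl d)) (S.plus (S.incl d))) {r : ℕ}
    (hΔ : ∀ q, finrank ℝ (Δ q) = r) (hD : finrank ℝ ED = finrank ℝ EQ + r) (d : D) {w : EV}
    (hm : flatDmap EV EQ S.minus (S.incl d) w ∈ (Δ (S.minus (S.incl d)) : Submodule ℝ EQ))
    (hp : flatDmap EV EQ S.plus (S.incl d) w ∈ (Δ (S.plus (S.incl d)) : Submodule ℝ EQ)) :
    ∃ u, flatDmap ED EV S.incl d u = w := by
  have : CompleteSpace ED := FiniteDimensional.complete ℝ ED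
  obtain ⟨i, hi⟩ := hcover (S.minus (S.incl d))
  obtain ⟨j, hj⟩ := hcover (S.plus (S.incl d))
  obtain ⟨hf, hfk, hfs⟩ := minus_transverse hUt hi
  obtain ⟨hg, hgk⟩ := plus_transverse hUt hj
  refine exists_preimage_of_mem_distribution (a := (flatDmap ED EV S.incl d).toLinearMap)
    (m := (flatDmap EV EQ S.minus (S.incl d)).toLinearMap)
    (p := (flatDmap EV EQ S.plus (S.incl d)).toLinearMap)
    (S.incl_emb.injective d) (S.eq_zero_of_flatDmap_eq_zero _) (S.surjective_flatDmap_minus_incl d)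
    hD (hΔ _) (hΔ _) (fun u hu => (hgk u).1 ?_) hm hp
  -- A vector `u` with `∂⁻`-component in `Δ` is tangent to a level set of the `∂⁻` coordinate. The
  -- `∂⁺` coordinate is constant on it, so its derivative along `u` vanishes.
  refine ker_le_of_eventually_eq (contDiffAt_chart hf)
    (hasFDerivAt_chart (hf.mdifferentiableAt one_ne_zero)) hfs
    (hasFDerivAt_chart (hg.mdifferentiableAt one_ne_zero)) ?_ ((hfk u).2 hu)
  have := eventually_plus_eq hUt hcover hreach hi hj
  rw [← eventually_chart (E := ED)] at this
  simpa using this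

/-- Locally, the velocity constraint contains the set of all points of `V` where the transverse
coordinates of `∂⁻` and `∂⁺` have given values. -/
theorem eventually_mem_constraint [SecondCountableTopology Q] [IsManifold 𝓘(ℝ, EV) ∞ V]
    [IsManifold 𝓘(ℝ, ED) ∞ D] [Countable ι]
    (hUt : ∀ i, IsFlowBox Δ (U i) (t i)) (hcover : ∀ q, ∃ i, q ∈ U i)
    (hreach : ∀ d, IsReachable Δ (S.minus (S.incl d)) (S.plus (S.incl d))) {r : ℕ}
    (hΔ : ∀ q, finrank ℝ (Δ q) = r) (hD : finrank ℝ ED = finrank ℝ EQ + r) {i j : ι} {d : D}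
    (hi : S.minus (S.incl d) ∈ U i) (hj : S.plus (S.incl d) ∈ U j) :
    ∀ᶠ v in 𝓝 (S.incl d), t i (S.minus v) = t i (S.minus (S.incl d)) →
      t j (S.plus v) = t j (S.plus (S.incl d)) → v ∈ S.constraint := by
  have : CompleteSpace ED := FiniteDimensional.complete ℝ ED
  obtain ⟨hf, hfk, hfs⟩ := minus_transverse hUt hi
  set v₀ := S.incl d with hv₀
  set φ := extChartAt 𝓘(ℝ, ED) d with hφ
  set ψ := extChartAt 𝓘(ℝ, EV) v₀ with hψ
  -- the embedding in charts
  have hh : HasStrictFDerivAt (ψ ∘ S.incl ∘ φ.symm) (flatDmap ED EV S.incl d) (φ d) := by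
    have h1 : ContMDiffAt 𝓘(ℝ, ED) 𝓘(ℝ, EV) 1 S.incl d :=
      (S.incl_emb.smooth.of_le (by simp)).contMDiffAt
    have h2 := (contMDiffAt_iff.1 h1).2
    rw [ModelWithCorners.range_eq_univ, contDiffWithinAt_univ] at h2
    have h3 : HasFDerivWithinAt (ψ ∘ S.incl ∘ φ.symm) (flatDmap ED EV S.incl d) univ (φ d) := by
      have := (h1.mdifferentiableAt one_ne_zero).hasMFDerivAt.2
      rw [ModelWithCorners.range_eq_univ] at this
      exact this
    exact ContDiffAt.hasStrictFDerivAt' h2 (hasFDerivWithinAt_univ.1 h3) one_ne_zero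
  have hbase : (ψ ∘ S.incl ∘ φ.symm) (φ d) = ψ v₀ := by simp [hφ, hv₀]
  -- the transverse coordinates in the chart of `V`
  have hmC : ContMDiffAt 𝓘(ℝ, EV) 𝓘(ℝ, F) 1 (fun v => t i (S.minus v)) v₀ :=
    ((hUt i).contMDiffAt _ hi).comp v₀ (S.minus_submersive.smooth.of_le (by simp)).contMDiffAt
  have hpC : ContMDiffAt 𝓘(ℝ, EV) 𝓘(ℝ, F) 1 (fun v => t j (S.plus v)) v₀ :=
    ((hUt j).contMDiffAt _ hj).comp v₀ (S.plus_submersive.smooth.of_le (by simp)).contMDiffAt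
  have hmd : flatDmap EV F (fun v => t i (S.minus v)) v₀ =
      (flatDmap EQ F (t i) (S.minus v₀)).comp (flatDmap EV EQ S.minus v₀) :=
    flatDmap_comp ((hUt i).mdifferentiableAt hi) (S.mdifferentiable_minus v₀) rfl
  have hpd : flatDmap EV F (fun v => t j (S.plus v)) v₀ =
      (flatDmap EQ F (t j) (S.plus v₀)).comp (flatDmap EV EQ S.plus v₀) :=
    flatDmap_comp ((hUt j).mdifferentiableAt hj) (S.mdifferentiable_plus v₀) rfl
  let Φ : V → F × F := fun v => (t i (S.minus v), t j (S.plus v))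
  let Φ' : EV →L[ℝ] F × F := (flatDmap EV F (fun v => t i (S.minus v)) v₀).prod
    (flatDmap EV F (fun v => t j (S.plus v)) v₀)
  have hΦ : HasStrictFDerivAt (Φ ∘ ψ.symm) Φ' ((ψ ∘ S.incl ∘ φ.symm) (φ d)) := by
    rw [hbase]
    exact ((contDiffAt_chart hmC).hasStrictFDerivAt'
      (hasFDerivAt_chart (hmC.mdifferentiableAt one_ne_zero)) one_ne_zero).prodMk
      ((contDiffAt_chart hpC).hasStrictFDerivAt'
      (hasFDerivAt_chart (hpC.mdifferentiableAt one_ne_zero)) one_ne_zero)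
  have hΦ' : Function.Surjective Φ' := by
    rintro ⟨x, y⟩
    obtain ⟨x', rfl⟩ := (hUt i).surjective _ hi x
    obtain ⟨y', rfl⟩ := (hUt j).surjective _ hj y
    obtain ⟨w, hw, hw'⟩ := exists_apply_eq_pair S.dim_eq
      (m := (flatDmap EV EQ S.minus v₀).toLinearMap) (p := (flatDmap EV EQ S.plus v₀).toLinearMap)
      (S.eq_zero_of_flatDmap_eq_zero _) x' y'
    refine ⟨w, Prod.ext ?_ ?_⟩
    · change flatDmap EV F (fun v => t i (S.minus v)) v₀ w = _
      rw [hmd]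
      exact congrArg (flatDmap EQ F (t i) (S.minus v₀)) hw
    · change flatDmap EV F (fun v => t j (S.plus v)) v₀ w = _
      rw [hpd]
      exact congrArg (flatDmap EQ F (t j) (S.plus v₀)) hw'
  have hker : ∀ w, Φ' w = 0 →
      ∃ u, flatDmap ED F (fun d => t i (S.minus (S.incl d))) d u = 0 ∧
        flatDmap ED EV S.incl d u = w := by
    intro w hw
    have hw1 : flatDmap EV F (fun v => t i (S.minus v)) v₀ w = 0 := congrArg Prod.fst hw
    have hw2 : flatDmap EV F (fun v => t j (S.plus v)) v₀ w = 0 := congrArg Prod.snd hw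
    rw [hmd] at hw1
    rw [hpd] at hw2
    have hm := ((hUt i).ker _ hi _).1 hw1
    obtain ⟨u, hu⟩ := exists_flatDmap_incl_eq hUt hcover hreach hΔ hD d hm
      (((hUt j).ker _ hj _).1 hw2)
    exact ⟨u, (hfk u).2 (hu ▸ hm), hu⟩
  have hfstrict := (contDiffAt_chart hf).hasStrictFDerivAt'
    (hasFDerivAt_chart (hf.mdifferentiableAt one_ne_zero)) one_ne_zero
  have hsrc : ∀ᶠ d' in 𝓝 d, S.incl d' ∈ ψ.source :=
    S.incl_emb.smooth.continuous.continuousAt.preimage_mem_nhds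
      (extChartAt_source_mem_nhds (I := 𝓘(ℝ, EV)) v₀)
  have hconst : ∀ᶠ q in 𝓝 (φ d),
      ((fun d => t i (S.minus (S.incl d))) ∘ φ.symm) q =
        ((fun d => t i (S.minus (S.incl d))) ∘ φ.symm) (φ d) →
      (Φ ∘ ψ.symm) ((ψ ∘ S.incl ∘ φ.symm) q) = (Φ ∘ ψ.symm) ((ψ ∘ S.incl ∘ φ.symm) (φ d)) := by
    filter_upwards [eventually_chart.2 (eventually_plus_eq hUt hcover hreach hi hj),
      eventually_chart.2 hsrc] with q hq hq' hfq
    have h1 : t i (S.minus (S.incl (φ.symm q))) = t i (S.minus v₀) := by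
      simpa [hφ] using hfq
    have h2 := hq h1
    have h3 : ψ.symm (ψ (S.incl (φ.symm q))) = S.incl (φ.symm q) := ψ.left_inv hq'
    have h4 : ψ.symm (ψ v₀) = v₀ := extChartAt_to_inv v₀
    rw [hbase]
    simp only [Function.comp_apply, h3, h4]
    exact Prod.ext h1 h2
  -- The set `N` keeps the point found on the constraint inside the chart domain of `V`, where
  -- equality in the chart gives equality in `V`.
  have key := eventually_mem_range_of_levelSet hh hΦ hΦ' hfstrict hfs hconst hker
    (N := {q | S.incl (φ.symm q) ∈ ψ.source}) (eventually_chart.2 hsrc)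
  rw [hbase] at key
  filter_upwards [(continuousAt_extChartAt (I := 𝓘(ℝ, EV)) v₀).eventually key,
    extChartAt_source_mem_nhds (I := 𝓘(ℝ, EV)) v₀] with v hv hvs h1 h2
  have h3 : ψ.symm (ψ v) = v := ψ.left_inv hvs
  have h4 : ψ.symm (ψ v₀) = v₀ := extChartAt_to_inv v₀
  obtain ⟨q, hq, hqv⟩ := hv (by
    change Φ (ψ.symm (ψ v)) = Φ (ψ.symm (ψ v₀))
    rw [h3, h4]
    exact Prod.ext h1 h2)
  exact ⟨φ.symm q, ψ.injOn hq hvs hqv⟩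

end DCLS

end Systems

/-! ### Momentum maps and invariance under the group. -/

section SymmetricSystems

variable {EQ : Type*} [NormedAddCommGroup EQ] [NormedSpace ℝ EQ] [FiniteDimensional ℝ EQ]
  {Q : Type*} [TopologicalSpace Q] [ChartedSpace EQ Q] [IsManifold 𝓘(ℝ, EQ) ∞ Q]
  {EV : Type*} [NormedAddCommGroup EV] [NormedSpace ℝ EV] [FiniteDimensional ℝ EV]
  {V : Type*} [TopologicalSpace V] [ChartedSpace EV V]
  {ED : Type*} [NormedAddCommGroup ED] [NormedSpace ℝ ED] [FiniteDimensional ℝ ED]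
  {D : Type*} [TopologicalSpace D] [ChartedSpace ED D]

namespace DiscreteTangentBundle

variable (B : DiscreteTangentBundle EQ Q EV V) (v : V) (w : TangentSpace 𝓘(ℝ, EV) v)

theorem plusPart_add_minusPart : B.plusPart v w + B.minusPart v w = w :=
  Submodule.projection_add_projection_eq_self (B.isCompl_vert v) w

theorem dmap_minus_plusPart : dmap EV EQ B.minus v (B.plusPart v w) = 0 :=
  Submodule.projection_apply_mem (B.isCompl_vert v) w

theorem dmap_plus_minusPart : dmap EV EQ B.plus v (B.minusPart v w) = 0 :=
  Submodule.projection_apply_mem (B.isCompl_vert v).symm w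

theorem dmap_plus_plusPart :
    dmap EV EQ B.plus v (B.plusPart v w) = dmap EV EQ B.plus v w := by
  conv_rhs => rw [← B.plusPart_add_minusPart v w, map_add, dmap_plus_minusPart, add_zero]

theorem dmap_minus_minusPart :
    dmap EV EQ B.minus v (B.minusPart v w) = dmap EV EQ B.minus v w := by
  conv_rhs => rw [← B.plusPart_add_minusPart v w, map_add, dmap_minus_plusPart, zero_add]

end DiscreteTangentBundle

variable {EG : Type*} [NormedAddCommGroup EG] [NormedSpace ℝ EG]
  {G : Type*} [TopologicalSpace G] [ChartedSpace EG G] [Group G] [LieGroup 𝓘(ℝ, EG) ∞ G]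
  [MulAction G Q] [ContMDiffSMul 𝓘(ℝ, EG) 𝓘(ℝ, EQ) ∞ G Q]
  [MulAction G V] [ContMDiffSMul 𝓘(ℝ, EG) 𝓘(ℝ, EV) ∞ G V]

namespace DCLS

variable {S : DCLS EQ Q EV V ED D}

/-- By the splitting of `ξ v`, the difference `J⁺ - J⁻` is `σ(ξ v)`. -/
theorem momentumPlus_eq_momentumMinus {v : V}
    (h : ∀ ξ : GroupLieAlgebra 𝓘(ℝ, EG) G, S.σ v (infGen G v ξ) = 0) :
    S.momentumPlus (EG := EG) G v = S.momentumMinus G v := by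
  ext ξ
  have h1 := h ξ
  rw [← S.plusPart_add_minusPart v (infGen G v ξ), map_add] at h1
  exact eq_neg_of_add_eq_zero_left h1

/-- Along solution pairs, the momentum is conserved if the infinitesimal generators at the
intermediate point are in the constraint force bundle. -/
theorem IsSolutionPair.momentumMinus_eq (hplus : ∀ (g : G) (v : V), S.plus (g • v) = g • S.plus v)
    (hminus : ∀ (g : G) (v : V), S.minus (g • v) = g • S.minus v) {d d' : D}
    (h : S.IsSolutionPair d d')
    (hforce : ∀ ξ : GroupLieAlgebra 𝓘(ℝ, EG) G, infGen G (S.plus (S.incl d)) ξ ∈ S.force d) :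
    S.momentumMinus (EG := EG) G (S.incl d') = S.momentumPlus G (S.incl d) := by
  obtain ⟨hdd, hσ⟩ := h
  ext ξ
  have hp : dmap EV EQ S.plus (S.incl d)
      (S.plusPart (S.incl d) (infGen G (S.incl d) ξ)) = infGen G (S.plus (S.incl d)) ξ := by
    rw [S.dmap_plus_plusPart]
    exact dmap_infGen hplus (S.mdifferentiable_plus _) ξ
  have hm : dmap EV EQ S.minus (S.incl d')
      (S.minusPart (S.incl d') (infGen G (S.incl d') ξ)) = infGen G (S.minus (S.incl d')) ξ := by
    rw [S.dmap_minus_minusPart]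
    exact dmap_infGen hminus (S.mdifferentiable_minus _) ξ
  -- The test variations are `(ξ v)⁺` and `(ξ v')⁻`. By equivariance both project to `ξ q` at the
  -- common point `q = ∂⁺ v = ∂⁻ v'`, and `ξ q` is in the constraint force bundle.
  have key := hσ _ _ (S.dmap_minus_plusPart (S.incl d) (infGen G (S.incl d) ξ))
    (S.dmap_plus_minusPart (S.incl d') (infGen G (S.incl d') ξ)) (by
      have h1 : (infGen G (S.plus (S.incl d)) ξ : EQ) = infGen G (S.minus (S.incl d')) ξ := by
        rw [hdd]
      exact hp.trans (h1.trans hm.symm)) (hp ▸ hforce ξ)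
  exact (eq_neg_of_add_eq_zero_left key).symm

/-- The chain is `J⁺(F v) = J⁻(F v) = J⁺(v)`. The first equality holds because `F v` is again in the
velocity constraint, the second by the variational principle. -/
theorem conservesMomentum (hplus : ∀ (g : G) (v : V), S.plus (g • v) = g • S.plus v)
    (hminus : ∀ (g : G) (v : V), S.minus (g • v) = g • S.minus v)
    (hσ₀ : ∀ v ∈ S.constraint, ∀ ξ : GroupLieAlgebra 𝓘(ℝ, EG) G, S.σ v (infGen G v ξ) = 0)
    (hforce : ∀ d, ∀ ξ : GroupLieAlgebra 𝓘(ℝ, EG) G, infGen G (S.plus (S.incl d)) ξ ∈ S.force d)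
    {F : V → V} {U W : Set V} (hF : S.IsEvolution F U W) :
    S.ConservesMomentum (EG := EG) G F U := by
  rintro _ ⟨hU, d, rfl⟩
  obtain ⟨d', hd', hsol⟩ := hF.solution d hU
  rw [← hd']
  have h1 := momentumPlus_eq_momentumMinus (hσ₀ _ ⟨d', rfl⟩)
  exact ⟨momentumPlus_eq_momentumMinus (hσ₀ _ ⟨d, rfl⟩), h1,
    h1.trans (hsol.momentumMinus_eq hplus hminus (hforce d))⟩

variable {Δ : ∀ q : Q, Submodule ℝ (TangentSpace 𝓘(ℝ, EQ) q)}

theorem isInvariantForce (hplus : ∀ (g : G) (v : V), S.plus (g • v) = g • S.plus v)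
    (hΔ : IsInvariantDistribution G Δ) (hforce : ∀ d, S.force d = Δ (S.plus (S.incl d))) :
    S.IsInvariantForce G := by
  intro g d d' hd
  have h1 : ∀ q q' : Q, q = q' → (Δ q : Submodule ℝ EQ) = (Δ q' : Submodule ℝ EQ) := by
    rintro q _ rfl
    rfl
  rw [hforce d, hforce d']
  exact (hΔ g _).trans (h1 _ _ (by rw [hd, hplus]))

/-- If small group elements preserve a closed velocity constraint, and the group is connected, then
the velocity constraint is invariant. -/
theorem smul_mem_constraint [IsTopologicalGroup G] [ConnectedSpace G]
    (hcont : ∀ v : V, Continuous fun g : G => g • v)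
    (hloc : ∀ v ∈ S.constraint, ∀ᶠ g : G in 𝓝 1, g • v ∈ S.constraint)
    (hclosed : IsClosed S.constraint) (g : G) {v : V} (hv : v ∈ S.constraint) :
    g • v ∈ S.constraint := by
  -- Openness at `g` is local invariance at the point `g • v`, moved from the identity to `g` by
  -- right translation.
  have hcl : IsClopen {g : G | g • v ∈ S.constraint} := by
    refine ⟨hclosed.preimage (hcont v), ?_⟩
    rw [isOpen_iff_mem_nhds]
    intro g hg
    have hc : ContinuousAt (fun g' : G => g' * g⁻¹) g := by fun_prop
    have hloc' := hloc _ hg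
    rw [← mul_inv_cancel g] at hloc'
    filter_upwards [hc.eventually hloc'] with g' hg'
    rwa [smul_smul, inv_mul_cancel_right] at hg'
  have h := hcl.eq_univ ⟨1, by simpa using hv⟩
  exact (Set.ext_iff.1 h g).2 (mem_univ g)

end DCLS

end SymmetricSystems

end DiscreteMechanics

end

theorem mainTheorem9
    {EQ : Type*} [NormedAddCommGroup EQ] [NormedSpace ℝ EQ] [FiniteDimensional ℝ EQ]
    {Q : Type*} [TopologicalSpace Q] [ChartedSpace EQ Q] [IsManifold 𝓘(ℝ, EQ) ∞ Q]
    [T2Space Q] [SecondCountableTopology Q]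
    {EV : Type*} [NormedAddCommGroup EV] [NormedSpace ℝ EV] [FiniteDimensional ℝ EV]
    {V : Type*} [TopologicalSpace V] [ChartedSpace EV V] [IsManifold 𝓘(ℝ, EV) ∞ V]
    [T2Space V] [SecondCountableTopology V]
    {ED : Type*} [NormedAddCommGroup ED] [NormedSpace ℝ ED] [FiniteDimensional ℝ ED]
    {D : Type*} [TopologicalSpace D] [ChartedSpace ED D] [IsManifold 𝓘(ℝ, ED) ∞ D]
    {EG : Type*} [NormedAddCommGroup EG] [NormedSpace ℝ EG] [FiniteDimensional ℝ EG]
    {G : Type*} [TopologicalSpace G] [ChartedSpace EG G] [Group G] [LieGroup 𝓘(ℝ, EG) ∞ G]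
    [MulAction G Q] [ContMDiffSMul 𝓘(ℝ, EG) 𝓘(ℝ, EQ) ∞ G Q]
    [MulAction G V] [ContMDiffSMul 𝓘(ℝ, EG) 𝓘(ℝ, EV) ∞ G V]
    (S : DiscreteMechanics.DCLS EQ Q EV V ED D)
    (Δ : ∀ q : Q, Submodule ℝ (TangentSpace 𝓘(ℝ, EQ) q))
    (hS : S.IsHolonomic Δ)
    (hplus : ∀ (g : G) (v : V), S.plus (g • v) = g • S.plus v)
    (hminus : ∀ (g : G) (v : V), S.minus (g • v) = g • S.minus v)
    (hΔ : DiscreteMechanics.IsInvariantDistribution G Δ)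
    (hgen : ∀ (ξ : GroupLieAlgebra 𝓘(ℝ, EG) G) (q : Q), DiscreteMechanics.infGen G q ξ ∈ Δ q)
    (hσ : DiscreteMechanics.IsInvariantForm G S.σ)
    (hσ₀ : ∀ v ∈ S.constraint, ∀ ξ : GroupLieAlgebra 𝓘(ℝ, EG) G,
      S.σ v (DiscreteMechanics.infGen G v ξ) = 0)
    (F : V → V) (U W : Set V) (hF : S.IsEvolution F U W) :
    (∀ (ξ : GroupLieAlgebra 𝓘(ℝ, EG) G) (d : D),
      DiscreteMechanics.infGen G (S.incl d) ξ ∈ S.tangentConstraint d) ∧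
    (∀ v ∈ S.constraint, ∀ᶠ g : G in 𝓝 1, g • v ∈ S.constraint) ∧
    S.IsInvariantForce G ∧
    (ConnectedSpace G → IsClosed S.constraint → S.IsSymmetric (EG := EG) G) ∧
    S.ConservesMomentum (EG := EG) G F U := by
  obtain ⟨r, hΔr, hD⟩ := hS.distribution_dim
  obtain ⟨c, O, t, hc, hUt, hcover⟩ :=
    DiscreteMechanics.exists_countable_flowBoxes hΔr hS.involutive
  have : Countable c := hc.to_subtype
  have hforce : ∀ d, ∀ ξ : GroupLieAlgebra 𝓘(ℝ, EG) G,
      DiscreteMechanics.infGen G (S.plus (S.incl d)) ξ ∈ S.force d := fun d ξ => by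
    rw [hS.force_eq]
    exact hgen ξ _
  have htangent : ∀ (ξ : GroupLieAlgebra 𝓘(ℝ, EG) G) (d : D),
      DiscreteMechanics.infGen G (S.incl d) ξ ∈ S.tangentConstraint d := by
    intro ξ d
    have hm := DiscreteMechanics.dmap_infGen hminus (S.mdifferentiable_minus (S.incl d)) ξ
    have hp := DiscreteMechanics.dmap_infGen hplus (S.mdifferentiable_plus (S.incl d)) ξ
    exact DiscreteMechanics.DCLS.exists_flatDmap_incl_eq hUt hcover hS.reachable hΔr.1 hD d
      (hm ▸ hgen ξ _) (hp ▸ hgen ξ _)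
  have hlocal : ∀ v ∈ S.constraint, ∀ᶠ g : G in 𝓝 1, g • v ∈ S.constraint := by
    rintro _ ⟨d, rfl⟩
    obtain ⟨i, hi⟩ := hcover (S.minus (S.incl d))
    obtain ⟨j, hj⟩ := hcover (S.plus (S.incl d))
    have hcont := (DiscreteMechanics.contMDiff_orbit EG G EV (S.incl d)).continuous.tendsto 1
    rw [one_smul] at hcont
    -- For `g` near the identity, `g` moves neither `∂⁻ v` nor `∂⁺ v` out of its plaque. By
    -- equivariance `g v` has the same transverse coordinates as `v`, and it is close enough to `v`
    -- to lie in the constraint.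
    filter_upwards [hcont.eventually (DiscreteMechanics.DCLS.eventually_mem_constraint hUt hcover
      hS.reachable hΔr.1 hD hi hj), (hUt i).eventually_smul_eq hgen hi,
      (hUt j).eventually_smul_eq hgen hj] with g hg h1 h2
    exact hg (by rw [hminus, h1]) (by rw [hplus, h2])
  have hinvariant : S.IsInvariantForce G :=
    DiscreteMechanics.DCLS.isInvariantForce hplus hΔ hS.force_eq
  refine ⟨htangent, hlocal, hinvariant, fun _ hclosed => ⟨hplus, hminus, hσ, fun g v hv => ?_,
    hinvariant, hσ₀⟩, DiscreteMechanics.DCLS.conservesMomentum hplus hminus hσ₀ hforce hF⟩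
  have : IsTopologicalGroup G := topologicalGroup_of_lieGroup 𝓘(ℝ, EG) ∞
  exact DiscreteMechanics.DCLS.smul_mem_constraint
    (fun v => (DiscreteMechanics.contMDiff_orbit EG G EV v).continuous) hlocal hclosed g hv
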